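/- For $t\in\mathbb R$ let $\|t\|$ denote the distance from $t$ to the nearest integer and $\{t\}$ its fractional part, and for a real sequence $(x_k)_{k\ge1}$ let $$D_N(x_k)=\sup_{0\le a<b\le 1}\left|\frac1N\sum_{k=1}^N I_{[a,b)}(\{x_k\})-(b-a)\right|\qquad(N=1,2,\dots)$$ be its discrepancy, where $I_{[a,b)}$ is the indicator function of $[a,b)$. Let $X_1,X_2,\dots$ be i.i.d. real random variables with characteristic function $\varphi(t)=\mathbb E\,e^{itX_1}$, and let $S_k=\sum_{j=1}^kX_j$. Let $\alpha\in\mathbb R$ be irrational such that $\|q\alpha\|\ge Cq^{-\gamma}$ for every integer $q\ge 1$, with some constants $\gamma\ge1$ and $C>0$. (i) Suppose there exist real numbers $0<\beta\le2$, $c>0$ and an integer $d>0$ such that $1-|\varphi(2\pi x)|\ge c\|dx\|^\beta$ for every $x\in\mathbb R$. Then, with $s=1$ if $0<\beta<2$ and $s=2$ if $\beta=2$, almost surely, as $N\to\infty$, $$D_N(\{S_k\alpha\})=\begin{cases}O\left(\sqrt{\frac{\log\log N}{N}}\,\log^sN\right)&\text{if }1\le\gamma\le 2/\beta,\\[1ex]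 O\left(\left(\frac{\log\log N}{N}\right)^{1/(\beta\gamma)}\right)&\text{if }\gamma>2/\beta.\end{cases}$$ (ii) Suppose there exist a real number $c>0$ and an integer $d>0$ such that $|\varphi(2\pi x)-\varphi(2\pi y)|\ge c\|d(x-y)\|$ for all $x,y\in\mathbb R$. Then, almost surely, as $N\to\infty$, $$D_N(\{S_k\alpha\})=\begin{cases}O\left(\sqrt{\frac{\log\log N}{N}}\,\log N\right)&\text{if }1\le\gamma\le2,\\[1ex] O\left(\left(\frac{\log\log N}{N}\right)^{1/\gamma}\right)&\text{if }\gamma>2.\end{cases}$$ -/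

import Mathlib

open Filter Asymptotics MeasureTheory ProbabilityTheory

noncomputable section

/-- `distInt t` is the distance `‖t‖` from the real number `t` to the nearest integer. -/
def distInt (t : ℝ) : ℝ := |t - round t|

/-- The proportion of the indices `1 ≤ k ≤ N` for which the fractional part of `x k` lies in
the interval `[a, b)`. -/
def visitFreq (x : ℕ → ℝ) (N : ℕ) (a b : ℝ) : ℝ :=
  (1 / (N : ℝ)) * ∑ k ∈ Finset.Icc 1 N, (Set.Ico a b).indicator (fun _ => (1 : ℝ)) (Int.fract (x k))

/-- The discrepancy `D_N(x_k)` of the first `N` terms `x 1, …, x N` of a sequence: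
the supremum over `0 ≤ a < b ≤ 1` of `|visitFreq x N a b - (b - a)|`. -/
def discrepancy (x : ℕ → ℝ) (N : ℕ) : ℝ :=
  sSup {r : ℝ | ∃ a b : ℝ, 0 ≤ a ∧ a < b ∧ b ≤ 1 ∧ r = |visitFreq x N a b - (b - a)|}

/-- The supremum that defines the discrepancy is that of a non-empty set. -/
theorem discrepancy_set_nonempty (x : ℕ → ℝ) (N : ℕ) :
    {r : ℝ | ∃ a b : ℝ, 0 ≤ a ∧ a < b ∧ b ≤ 1 ∧
      r = |visitFreq x N a b - (b - a)|}.Nonempty :=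
  ⟨_, 0, 1, le_rfl, zero_lt_one, le_rfl, rfl⟩

/-- The supremum that defines the discrepancy is that of a set bounded above by `1`. -/
theorem discrepancy_set_bddAbove (x : ℕ → ℝ) (N : ℕ) :
    BddAbove {r : ℝ | ∃ a b : ℝ, 0 ≤ a ∧ a < b ∧ b ≤ 1 ∧
      r = |visitFreq x N a b - (b - a)|} := by
  refine ⟨1, ?_⟩
  rintro r ⟨a, b, ha, hab, hb, rfl⟩
  have h0 : 0 ≤ visitFreq x N a b :=
    mul_nonneg (by positivity)
      (Finset.sum_nonneg fun k _ => Set.indicator_nonneg (fun _ _ => zero_le_one) _)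
  have h1 : visitFreq x N a b ≤ 1 := by
    have hs : ∑ k ∈ Finset.Icc 1 N,
        (Set.Ico a b).indicator (fun _ => (1 : ℝ)) (Int.fract (x k)) ≤ N := by
      calc _ ≤ ∑ _k ∈ Finset.Icc 1 N, (1 : ℝ) :=
            Finset.sum_le_sum fun k _ => Set.indicator_le_self' (fun _ _ => zero_le_one) _
        _ = N := by simp
    unfold visitFreq
    rw [one_div_mul_eq_div]
    exact div_le_one_of_le₀ hs (Nat.cast_nonneg N)
  rw [abs_le]
  constructor <;> linarith

/-- The random walk `S_k = X_1 + ⋯ + X_k`; the steps `X_1, X_2, …` are `X 0, X 1, …`. -/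
def randomWalk {Ω : Type*} (X : ℕ → Ω → ℝ) (k : ℕ) (ω : Ω) : ℝ :=
  ∑ j ∈ Finset.range k, X j ω

end

/-!
The hypotheses of both parts enter only through `‖1 - φ(2πx)‖ ≥ c ‖dx‖ ^ β`, with `β = 1` in the
second part (take `y = 0`). The proof combines three ingredients.

*Erdős–Turán.* The local discrepancies of `N` points are the increments of a sawtooth average with
slope at least `-1`; comparing it with its convolution by a Fejér kernel of degree `< H` gives
`D_N ≪ 1 / H + ∑_{h ≤ H} h⁻¹ |N⁻¹ ∑_k e(h x_k)|` (`discrepancy_le_erdosTuran`).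

*Martingales.* Put `z_h = φ(2πhα)`. Since `E[e(hα S_{k+1}) | S_1, …, S_k] = z_h e(hα S_k)`, the sum
`∑_{k ≤ n} e(hα S_k)` is, up to a bounded error, `M_h(n) / (1 - z_h)` for a martingale `M_h` with
bounded increments of conditional variance `1 - |z_h|² ≤ 2 |1 - z_h|`. Hence, for `l` not too large,
`exp(l |M_h(n)| / 2)` has expectation at most `4 exp(2 n l² |1 - z_h|)`. By convexity of the
exponential, a weighted mean of these bounds over `h` controls the whole weighted sum
`∑_h h⁻¹ |M_h(n)| / |1 - z_h|`, and Doob's maximal inequality for that mean controls it for all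
`n ≤ N` at once (`measure_exists_weightedSum_ge_le`). With Borel–Cantelli along `N = 2 ^ m` this
gives almost surely, for `H` up to `(n / log log n) ^ (1 / E)` with `E = max(2, βγ)`,
`∑_{h ≤ H} h⁻¹ |∑_{k ≤ n} e(hα S_k)| ≪ √(n log log n) ∑_{h ≤ H} h⁻¹ |1 - z_h| ^ (-1/2)`;
at these frequencies `|1 - z_h| ≫ log log n / n`
(`exists_ae_eventually_weighted_exponentialSum_le`).

*Diophantine sums.* It remains to bound `∑_{h ≤ H} h⁻¹ ‖hdα‖ ^ (-β/2)`. If `q ≤ X` minimizes `‖qα‖`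
among the integers up to `X`, then the points `hα` with `h` in a block of length `q` are
`1 / (2q)`-separated modulo `1`, so that a block contributes `O(∑_{i ≤ 2q} (q / i) ^ p)` apart
from at most two terms, each of size at most `‖qα‖ ^ (-p) ≪ q ^ (γp)`
(`exists_sum_distInt_rpow_le`). Partial summation yields the orders `log H`, `log² H` and
`H ^ (γp - 1)` for `p = β / 2`, according to whether `γp ≤ 1` with `p < 1`, `γp ≤ 1` with `p = 1`,
or `γp > 1`. Inserting the largest admissible `H` gives the stated rates.
-/

/-! ### The additive character of `ℝ / ℤ` -/

/-- The character `e(x) = exp(2πix)` of `ℝ / ℤ`. -/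
noncomputable def unitExp (x : ℝ) : ℂ := Complex.exp ((2 * Real.pi * x : ℝ) * Complex.I)

theorem norm_unitExp (x : ℝ) : ‖unitExp x‖ = 1 := Complex.norm_exp_ofReal_mul_I _

theorem unitExp_zero : unitExp 0 = 1 := by simp [unitExp]

theorem unitExp_add (x y : ℝ) : unitExp (x + y) = unitExp x * unitExp y := by
  rw [unitExp, unitExp, unitExp, ← Complex.exp_add]
  congr 1
  push_cast
  ring

theorem unitExp_intCast (n : ℤ) : unitExp n = 1 := by
  rw [unitExp, ← Complex.exp_int_mul_two_pi_mul_I n]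
  congr 1
  push_cast
  ring

theorem unitExp_add_intCast (x : ℝ) (n : ℤ) : unitExp (x + n) = unitExp x := by
  rw [unitExp_add, unitExp_intCast, mul_one]

theorem conj_unitExp (x : ℝ) : (starRingEnd ℂ) (unitExp x) = unitExp (-x) := by
  rw [unitExp, unitExp, ← Complex.exp_conj, map_mul, Complex.conj_I, Complex.conj_ofReal]
  congr 1
  push_cast
  ring

theorem continuous_unitExp : Continuous unitExp := by
  unfold unitExp
  fun_prop

theorem unitExp_natCast_mul (n : ℕ) (x : ℝ) : unitExp (n * x) = unitExp x ^ n := by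
  rw [unitExp, unitExp, ← Complex.exp_nat_mul]
  congr 1
  push_cast
  ring

theorem unitExp_mul_fract (h : ℕ) (x : ℝ) : unitExp (h * Int.fract x) = unitExp (h * x) := by
  have : (h : ℝ) * x = h * Int.fract x + ((h * ⌊x⌋ : ℤ) : ℝ) := by
    push_cast
    rw [← mul_add, Int.fract_add_floor]
  rw [this, unitExp_add_intCast]

theorem hasDerivAt_unitExp_mul (n x : ℝ) :
    HasDerivAt (fun v : ℝ => unitExp (n * v))
      (unitExp (n * x) * ((2 * Real.pi * n : ℝ) * Complex.I)) x := by
  unfold unitExp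
  have h : HasDerivAt (fun v : ℝ => (((2 * Real.pi * (n * v) : ℝ) : ℂ) * Complex.I))
      ((2 * Real.pi * n : ℝ) * Complex.I) x := by
    refine HasDerivAt.mul_const ?_ _
    refine HasDerivAt.ofReal_comp ?_
    have := ((hasDerivAt_id x).const_mul n).const_mul (2 * Real.pi)
    simpa using this
  exact h.cexp

/-- The lower bound `|1 - e(u)| = 2 |sin πu| ≥ 4|u|` on a fundamental domain. -/
theorem four_mul_abs_le_norm_one_sub_unitExp {u : ℝ} (hu : |u| ≤ 1 / 2) :
    4 * |u| ≤ ‖1 - unitExp u‖ := by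
  have hpi := Real.pi_pos
  have h1 : ‖1 - unitExp u‖ = 2 * |Real.sin (Real.pi * u)| := by
    rw [norm_sub_rev, unitExp, mul_comm _ Complex.I, Complex.norm_exp_I_mul_ofReal_sub_one]
    rw [norm_mul, Real.norm_eq_abs, Real.norm_eq_abs]
    simp only [Nat.abs_ofNat]
    congr 3
    ring
  have h2 : 2 / Real.pi * (Real.pi * |u|) ≤ Real.sin (Real.pi * |u|) :=
    Real.mul_le_sin (by positivity) (by nlinarith)
  have h3 : Real.sin (Real.pi * |u|) ≤ |Real.sin (Real.pi * u)| := by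
    rcases abs_cases u with ⟨h, _⟩ | ⟨h, _⟩
    · rw [h]
      exact le_abs_self _
    · rw [h, mul_neg, Real.sin_neg]
      exact neg_le_abs _
  have h4 : 2 / Real.pi * (Real.pi * |u|) = 2 * |u| := by
    field_simp
  rw [h1]
  linarith

/-! ### The Erdős–Turán inequality -/

/-- The sawtooth average `t ↦ N⁻¹ ∑ {x_k - t}`. Its increments over `[a, b]` are the local
discrepancies of the first `N` points. -/
noncomputable def sawtoothMean (x : ℕ → ℝ) (N : ℕ) (t : ℝ) : ℝ :=
  (1 / (N : ℝ)) * ∑ k ∈ Finset.Icc 1 N, Int.fract (x k - t)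

theorem fract_sub_of_mem {f a : ℝ} (hf0 : 0 ≤ f) (hf1 : f < 1) (ha0 : 0 ≤ a) (ha1 : a ≤ 1) :
    Int.fract (f - a) = f - a + if f < a then 1 else 0 := by
  rw [Int.fract_eq_iff]
  split_ifs with h
  · exact ⟨by linarith, by linarith, -1, by push_cast; ring⟩
  · exact ⟨by linarith, by linarith, 0, by push_cast; ring⟩

theorem fract_sub_eq_fract_fract_sub (x a : ℝ) :
    Int.fract (x - a) = Int.fract (Int.fract x - a) := by
  rw [Int.fract_eq_fract]
  exact ⟨⌊x⌋, by rw [Int.fract]; ring⟩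

theorem visitFreq_sub_length {x : ℕ → ℝ} {N : ℕ} (hN : 0 < N) {a b : ℝ} (ha : 0 ≤ a) (hab : a < b)
    (hb : b ≤ 1) :
    visitFreq x N a b - (b - a) = sawtoothMean x N b - sawtoothMean x N a := by
  have hN' : (N : ℝ) ≠ 0 := by positivity
  have key : ∀ k, (Set.Ico a b).indicator (fun _ => (1 : ℝ)) (Int.fract (x k)) - (b - a)
      = Int.fract (x k - b) - Int.fract (x k - a) := by
    intro k
    rw [fract_sub_eq_fract_fract_sub (x k) b, fract_sub_eq_fract_fract_sub (x k) a]
    have h0 := Int.fract_nonneg (x k)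
    have h1 := Int.fract_lt_one (x k)
    rw [fract_sub_of_mem h0 h1 (by linarith) hb, fract_sub_of_mem h0 h1 ha (by linarith),
      Set.indicator_apply]
    simp only [Set.mem_Ico]
    split_ifs <;> first | (exfalso; grind) | ring
  rw [visitFreq, sawtoothMean, sawtoothMean, ← mul_sub, ← Finset.sum_sub_distrib,
    ← Finset.sum_congr rfl (fun k _ => key k), Finset.sum_sub_distrib]
  simp only [Finset.sum_const, Nat.card_Icc, nsmul_eq_mul, Nat.add_sub_cancel]
  field_simp

theorem sawtoothMean_nonneg (x : ℕ → ℝ) (N : ℕ) (t : ℝ) : 0 ≤ sawtoothMean x N t :=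
  mul_nonneg (by positivity) (Finset.sum_nonneg fun _ _ => Int.fract_nonneg _)

theorem sawtoothMean_le_one (x : ℕ → ℝ) (N : ℕ) (t : ℝ) : sawtoothMean x N t ≤ 1 := by
  rw [sawtoothMean, one_div_mul_eq_div]
  refine div_le_one_of_le₀ ?_ (Nat.cast_nonneg N)
  calc _ ≤ ∑ _k ∈ Finset.Icc 1 N, (1 : ℝ) :=
        Finset.sum_le_sum fun k _ => (Int.fract_lt_one _).le
    _ = N := by simp

/-- The sawtooth average decreases with slope at most `1`. -/
theorem sawtoothMean_sub_le (x : ℕ → ℝ) (N : ℕ) (s : ℝ) {y : ℝ} (hy : 0 ≤ y) :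
    sawtoothMean x N s - y ≤ sawtoothMean x N (s + y) := by
  rcases Nat.eq_zero_or_pos N with rfl | hN
  · simp [sawtoothMean, hy]
  have hN' : (0 : ℝ) < N := by positivity
  have key : ∀ k, Int.fract (x k - s) - y ≤ Int.fract (x k - (s + y)) := by
    intro k
    have : ((⌊x k - (s + y)⌋ : ℤ) : ℝ) ≤ ⌊x k - s⌋ := by
      exact_mod_cast Int.floor_le_floor (by linarith)
    rw [Int.fract, Int.fract]
    linarith
  have h := Finset.sum_le_sum (s := Finset.Icc 1 N) fun k _ => key k
  rw [Finset.sum_sub_distrib] at h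
  simp only [Finset.sum_const, Nat.card_Icc, nsmul_eq_mul, Nat.add_sub_cancel] at h
  rw [sawtoothMean, sawtoothMean]
  have h2 : (1 / (N : ℝ)) * (N * y) = y := by field_simp
  calc _ = (1 / (N : ℝ)) * (∑ k ∈ Finset.Icc 1 N, Int.fract (x k - s) - N * y) := by
        rw [mul_sub, h2]
    _ ≤ _ := by gcongr

theorem measurable_sawtoothMean (x : ℕ → ℝ) (N : ℕ) : Measurable (sawtoothMean x N) := by
  unfold sawtoothMean
  refine Measurable.const_mul ?_ _
  refine Finset.measurable_sum _ fun k _ => ?_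
  exact measurable_fract.comp (by fun_prop)

/-- The Fejér kernel `M⁻¹ |∑_{j < M} e(ju)|²`. -/
noncomputable def fejerKernel (M : ℕ) (u : ℝ) : ℝ :=
  (1 / (M : ℝ)) * ‖∑ j ∈ Finset.range M, unitExp (j * u)‖ ^ 2

theorem fejerKernel_nonneg (M : ℕ) (u : ℝ) : 0 ≤ fejerKernel M u := by
  unfold fejerKernel
  positivity

theorem continuous_fejerKernel (M : ℕ) : Continuous (fejerKernel M) := by
  unfold fejerKernel
  refine Continuous.mul continuous_const (Continuous.pow (Continuous.norm ?_) 2)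
  exact continuous_finsetSum _ fun j _ => continuous_unitExp.comp (by fun_prop)

theorem ofReal_fejerKernel (M : ℕ) (u : ℝ) : (fejerKernel M u : ℂ) =
    (1 / (M : ℂ)) * ∑ i ∈ Finset.range M, ∑ j ∈ Finset.range M,
      unitExp (((i : ℤ) - (j : ℤ) : ℤ) * u) := by
  rw [fejerKernel]
  push_cast
  rw [← Complex.mul_conj', map_sum, Finset.sum_mul_sum]
  congr 1
  refine Finset.sum_congr rfl fun i _ => Finset.sum_congr rfl fun j _ => ?_
  rw [conj_unitExp, ← unitExp_add]
  congr 1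
  ring

theorem fejerKernel_le {M : ℕ} (hM : 0 < M) {u : ℝ} (hu0 : u ≠ 0) (hu : |u| ≤ 1 / 2) :
    fejerKernel M u ≤ 1 / (4 * M * u ^ 2) := by
  have hM' : (0 : ℝ) < M := by positivity
  have hu1 : 0 < |u| := abs_pos.2 hu0
  have h4 := four_mul_abs_le_norm_one_sub_unitExp hu
  have hgeom : ‖∑ j ∈ Finset.range M, unitExp (j * u)‖ * ‖1 - unitExp u‖ ≤ 2 := by
    rw [← norm_mul]
    simp_rw [unitExp_natCast_mul]
    rw [geom_sum_mul_neg]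
    refine (norm_sub_le _ _).trans ?_
    rw [norm_pow, norm_unitExp]
    norm_num
  have h5 : ‖∑ j ∈ Finset.range M, unitExp (j * u)‖ ≤ 1 / (2 * |u|) := by
    rw [le_div_iff₀ (by positivity)]
    nlinarith [norm_nonneg (∑ j ∈ Finset.range M, unitExp (j * u))]
  have h6 : ‖∑ j ∈ Finset.range M, unitExp (j * u)‖ ^ 2 ≤ (1 / (2 * |u|)) ^ 2 := by gcongr
  calc fejerKernel M u ≤ (1 / (M : ℝ)) * (1 / (2 * |u|)) ^ 2 := by
        unfold fejerKernel
        gcongr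
    _ = 1 / (4 * M * u ^ 2) := by
        rw [div_pow, mul_pow, sq_abs]
        field_simp
        norm_num

/-- The mass of the Fejér kernel outside `[-t, t]` is dominated by an integrable function whose
integral is explicit. -/
theorem indicator_mul_fejerKernel_le {M : ℕ} (hM : 0 < M) {t u : ℝ} (ht : 0 < t)
    (hu : |u| ≤ 1 / 2) :
    (if t < |u| then 1 else 0) * fejerKernel M u ≤ 1 / (2 * M) * (u ^ 2 + t ^ 2)⁻¹ := by
  have hM' : (0 : ℝ) < M := by positivity
  split_ifs with h
  · have hu0 : u ≠ 0 := by
      rintro rfl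
      simp at h
      linarith
    rw [one_mul]
    refine (fejerKernel_le hM hu0 hu).trans ?_
    have hsq : t ^ 2 ≤ u ^ 2 := by
      rw [← sq_abs u]
      gcongr
    have hu2 : 0 < u ^ 2 := by positivity
    rw [← div_eq_mul_inv, div_div]
    refine one_div_le_one_div_of_le (by positivity) ?_
    nlinarith
  · rw [zero_mul]
    positivity

theorem integral_inv_sq_add_sq_le {t : ℝ} (ht : 0 < t) (a b : ℝ) :
    ∫ u in a..b, (u ^ 2 + t ^ 2)⁻¹ ≤ Real.pi / t := by
  have h : ∀ u : ℝ, HasDerivAt (fun u : ℝ => Real.arctan (u / t) / t) ((u ^ 2 + t ^ 2)⁻¹) u := by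
    intro u
    have := (((hasDerivAt_id u).div_const t).arctan).div_const t
    refine this.congr_deriv ?_
    simp only [id]
    field_simp
    ring
  rw [intervalIntegral.integral_eq_sub_of_hasDerivAt (fun u _ => h u)]
  · rw [← sub_div]
    gcongr
    linarith [Real.arctan_lt_pi_div_two (b / t), Real.neg_pi_div_two_lt_arctan (a / t)]
  · refine Continuous.intervalIntegrable ?_ _ _
    refine Continuous.inv₀ (by fun_prop) fun u => ?_
    positivity

theorem integral_unitExp_mul {n : ℤ} (hn : n ≠ 0) (a : ℝ) :
    ∫ u in a..a + 1, unitExp (n * u) = 0 := by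
  have hc : ((2 * Real.pi * n : ℝ) * Complex.I) ≠ 0 := by
    simp [Real.pi_ne_zero, hn]
  have hd : ∀ u ∈ Set.uIcc a (a + 1), HasDerivAt
      (fun v : ℝ => unitExp (n * v) / ((2 * Real.pi * n : ℝ) * Complex.I)) (unitExp (n * u)) u := by
    intro u _
    have := (hasDerivAt_unitExp_mul n u).div_const ((2 * Real.pi * n : ℝ) * Complex.I)
    rwa [mul_div_cancel_right₀ _ hc] at this
  rw [intervalIntegral.integral_eq_sub_of_hasDerivAt hd
    ((continuous_unitExp.comp (by fun_prop)).intervalIntegrable _ _)]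
  rw [mul_add, mul_one, unitExp_add_intCast, sub_self]

theorem integral_fejerKernel {M : ℕ} (hM : 0 < M) :
    ∫ u in (-(1 / 2) : ℝ)..(1 / 2), fejerKernel M u = 1 := by
  have hM' : (M : ℂ) ≠ 0 := by exact_mod_cast hM.ne'
  have h : ((∫ u in (-(1 / 2) : ℝ)..(1 / 2), fejerKernel M u : ℝ) : ℂ) = 1 := by
    rw [← intervalIntegral.integral_ofReal]
    simp_rw [ofReal_fejerKernel]
    rw [intervalIntegral.integral_const_mul, intervalIntegral.integral_finsetSum]
    swap
    · intro i _
      exact (continuous_finsetSum _ fun j _ =>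
        continuous_unitExp.comp (by fun_prop)).intervalIntegrable _ _
    have : ∀ i ∈ Finset.range M, ∫ u in (-(1 / 2) : ℝ)..(1 / 2), ∑ j ∈ Finset.range M,
        unitExp (((i : ℤ) - (j : ℤ) : ℤ) * u) = 1 := by
      intro i hi
      rw [intervalIntegral.integral_finsetSum]
      swap
      · intro j _
        exact (continuous_unitExp.comp (by fun_prop)).intervalIntegrable _ _
      rw [Finset.sum_eq_single_of_mem i hi]
      · simp [unitExp_zero]
        norm_num
      · intro j _ hj
        have h2 := integral_unitExp_mul (n := (i : ℤ) - (j : ℤ)) (by omega) (-(1 / 2))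
        rwa [show -(1 / 2 : ℝ) + 1 = 1 / 2 by norm_num] at h2
    rw [Finset.sum_congr rfl this]
    simp [hM']
  exact_mod_cast h

/-- The Fourier coefficients of the sawtooth function. -/
theorem integral_fract_mul_unitExp {n : ℤ} (hn : n ≠ 0) (y : ℝ) :
    ∫ u in (-(1 / 2) : ℝ)..(1 / 2), ((Int.fract (y + u) : ℝ) : ℂ) * unitExp (n * u)
      = unitExp (-(n * y)) / ((2 * Real.pi * n : ℝ) * Complex.I) := by
  have hc : ((2 * Real.pi * n : ℝ) * Complex.I) ≠ 0 := by
    simp [Real.pi_ne_zero, hn]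
  have hper : Function.Periodic (fun v : ℝ => ((Int.fract v : ℝ) : ℂ) * unitExp (n * v)) 1 := by
    intro v
    simp only [Int.fract_add_one, mul_add, mul_one, unitExp_add_intCast]
  have h1 : ∀ u : ℝ, ((Int.fract (y + u) : ℝ) : ℂ) * unitExp (n * u) = unitExp (-(n * y)) *
      (((Int.fract (y + u) : ℝ) : ℂ) * unitExp (n * (y + u))) := by
    intro u
    have : (n : ℝ) * u = -(n * y) + n * (y + u) := by ring
    rw [this, unitExp_add]
    ring
  simp_rw [h1]
  rw [intervalIntegral.integral_const_mul,
    intervalIntegral.integral_comp_add_left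
      (fun v : ℝ => ((Int.fract v : ℝ) : ℂ) * unitExp (n * v)) y]
  have h2 : y + 1 / 2 = (y + -(1 / 2)) + 1 := by ring
  rw [h2, hper.intervalIntegral_add_eq _ 0, zero_add]
  have h3 : ∫ v in (0 : ℝ)..1, ((Int.fract v : ℝ) : ℂ) * unitExp (n * v)
      = ∫ v in (0 : ℝ)..1, (v : ℂ) * unitExp (n * v) := by
    refine intervalIntegral.integral_congr_ae ?_
    have h0 : ∀ᵐ v : ℝ, v ≠ 1 := by simp [ae_iff, measure_singleton]
    filter_upwards [h0] with v hv hv'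
    rw [Set.uIoc_of_le zero_le_one] at hv'
    rw [Int.fract_eq_self.2 ⟨hv'.1.le, lt_of_le_of_ne hv'.2 hv⟩]
  have hd : ∀ v ∈ Set.uIcc (0 : ℝ) 1, HasDerivAt (fun v : ℝ =>
      (v : ℂ) * (unitExp (n * v) / ((2 * Real.pi * n : ℝ) * Complex.I))
        - unitExp (n * v) / ((2 * Real.pi * n : ℝ) * Complex.I)
          / ((2 * Real.pi * n : ℝ) * Complex.I)) ((v : ℂ) * unitExp (n * v)) v := by
    intro v _
    have e1 := (hasDerivAt_unitExp_mul n v).div_const ((2 * Real.pi * n : ℝ) * Complex.I)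
    rw [mul_div_cancel_right₀ _ hc] at e1
    have e2 := e1.div_const ((2 * Real.pi * n : ℝ) * Complex.I)
    refine (((Complex.ofRealCLM.hasDerivAt (x := v)).mul e1).sub e2).congr_deriv ?_
    simp only [Complex.ofRealCLM_apply, Complex.ofReal_one, one_mul]
    ring
  rw [h3, intervalIntegral.integral_eq_sub_of_hasDerivAt hd]
  · have : unitExp ((n : ℝ) * 1) = 1 := by rw [mul_one, unitExp_intCast]
    rw [this, mul_zero, unitExp_zero]
    push_cast
    ring
  · exact (Complex.continuous_ofReal.mul
      (continuous_unitExp.comp (by fun_prop))).intervalIntegrable _ _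

/-- The convolution of the sawtooth average with the Fejér kernel. -/
noncomputable def sawtoothConv (x : ℕ → ℝ) (N M : ℕ) (t : ℝ) : ℝ :=
  ∫ u in (-(1 / 2) : ℝ)..(1 / 2), sawtoothMean x N (t - u) * fejerKernel M u

theorem intervalIntegrable_sawtoothMean_mul (x : ℕ → ℝ) (N M : ℕ) (t a b : ℝ) :
    IntervalIntegrable (fun u => sawtoothMean x N (t - u) * fejerKernel M u) volume a b := by
  have h : IntervalIntegrable (fun u => sawtoothMean x N (t - u)) volume a b := by
    refine (intervalIntegrable_const (c := (1 : ℝ))).mono_fun ?_ ?_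
    · exact ((measurable_sawtoothMean x N).comp (by fun_prop)).aestronglyMeasurable
    · refine Filter.Eventually.of_forall fun u => ?_
      simp only [norm_one]
      rw [Real.norm_of_nonneg (sawtoothMean_nonneg _ _ _)]
      exact sawtoothMean_le_one _ _ _
  exact h.mul_continuousOn (continuous_fejerKernel M).continuousOn

theorem intervalIntegrable_fract_mul_unitExp (n : ℤ) (y a b : ℝ) :
    IntervalIntegrable (fun u : ℝ => ((Int.fract (y + u) : ℝ) : ℂ) * unitExp (n * u))
      volume a b := by
  have h : IntervalIntegrable (fun u : ℝ => ((Int.fract (y + u) : ℝ) : ℂ)) volume a b := by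
    refine (intervalIntegrable_const (c := (1 : ℝ))).mono_fun ?_ ?_
    · refine (Complex.measurable_ofReal.comp
        (measurable_fract.comp (by fun_prop))).aestronglyMeasurable
    · refine Filter.Eventually.of_forall fun u => ?_
      simp only [Complex.norm_real, norm_one]
      rw [Real.norm_of_nonneg (Int.fract_nonneg _)]
      exact (Int.fract_lt_one _).le
  exact h.mul_continuousOn (continuous_unitExp.comp (by fun_prop)).continuousOn

theorem integral_fract_add (y : ℝ) :
    ∫ u in (-(1 / 2) : ℝ)..(1 / 2), ((Int.fract (y + u) : ℝ) : ℂ) = 1 / 2 := by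
  have hper : Function.Periodic (fun v : ℝ => ((Int.fract v : ℝ) : ℂ)) 1 := by
    intro v
    simp only [Int.fract_add_one]
  rw [intervalIntegral.integral_comp_add_left (fun v : ℝ => ((Int.fract v : ℝ) : ℂ)) y]
  have h2 : y + 1 / 2 = (y + -(1 / 2)) + 1 := by ring
  rw [h2, hper.intervalIntegral_add_eq _ 0, zero_add]
  have h3 : ∫ v in (0 : ℝ)..1, ((Int.fract v : ℝ) : ℂ) = ∫ v in (0 : ℝ)..1, (v : ℂ) := by
    refine intervalIntegral.integral_congr_ae ?_
    have h0 : ∀ᵐ v : ℝ, v ≠ 1 := by simp [ae_iff, measure_singleton]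
    filter_upwards [h0] with v hv hv'
    rw [Set.uIoc_of_le zero_le_one] at hv'
    rw [Int.fract_eq_self.2 ⟨hv'.1.le, lt_of_le_of_ne hv'.2 hv⟩]
  rw [h3, intervalIntegral.integral_ofReal, integral_id]
  norm_num

/-- Each frequency `n = i - j` of the Fejér kernel contributes the corresponding exponential sum
divided by `2π|n|`; the frequency `0`, for which this weight is `0` by the convention `1 / 0 = 0`,
contributes the mean value `1 / 2` of the sawtooth. -/
theorem norm_integral_sawtoothMean_mul_unitExp_le {x : ℕ → ℝ} {N : ℕ} (hN : 0 < N) (n : ℤ)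
    (t : ℝ) :
    ‖(∫ u in (-(1 / 2) : ℝ)..(1 / 2), (sawtoothMean x N (t - u) : ℂ) * unitExp (n * u))
        - (if n = 0 then 1 / 2 else 0)‖ ≤
      1 / (2 * Real.pi * n.natAbs) *
        (‖∑ k ∈ Finset.Icc 1 N, unitExp (n.natAbs * x k)‖ / N) := by
  have hN' : (N : ℂ) ≠ 0 := by exact_mod_cast hN.ne'
  have hexp : ∀ u : ℝ, (sawtoothMean x N (t - u) : ℂ) * unitExp (n * u) =
      (1 / (N : ℂ)) * ∑ k ∈ Finset.Icc 1 N,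
        ((Int.fract ((x k - t) + u) : ℝ) : ℂ) * unitExp (n * u) := by
    intro u
    rw [sawtoothMean]
    push_cast
    rw [mul_assoc, Finset.sum_mul]
    congr 1
    refine Finset.sum_congr rfl fun k _ => ?_
    rw [show x k - (t - u) = x k - t + u by ring]
  simp_rw [hexp]
  rw [intervalIntegral.integral_const_mul, intervalIntegral.integral_finsetSum
    (fun k _ => intervalIntegrable_fract_mul_unitExp n _ _ _)]
  by_cases hn : n = 0
  · subst hn
    simp only [Int.cast_zero, zero_mul, unitExp_zero, mul_one, integral_fract_add]
    simp [hN']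
  · rw [if_neg hn, sub_zero]
    simp_rw [integral_fract_mul_unitExp hn]
    rw [← Finset.sum_div]
    have hsum : ‖∑ k ∈ Finset.Icc 1 N, unitExp (-(n * (x k - t)))‖
        = ‖∑ k ∈ Finset.Icc 1 N, unitExp (n.natAbs * x k)‖ := by
      have h1 : ∀ k, unitExp (-(n * (x k - t))) = unitExp (n * t) * unitExp (-(n * x k)) := by
        intro k
        rw [← unitExp_add]
        congr 1
        ring
      simp_rw [h1]
      rw [← Finset.mul_sum, norm_mul, norm_unitExp, one_mul]
      rcases Int.natAbs_eq n with h | h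
      · have h2 : (n : ℝ) = (n.natAbs : ℝ) := by
          conv_lhs => rw [h]
          rw [Int.cast_natCast]
        rw [← RCLike.norm_conj, map_sum]
        simp_rw [conj_unitExp, neg_neg, h2]
      · have h2 : (n : ℝ) = -(n.natAbs : ℝ) := by
          conv_lhs => rw [h]
          rw [Int.cast_neg, Int.cast_natCast]
        simp_rw [h2, neg_mul, neg_neg]
    rw [norm_mul, norm_div, norm_div, hsum, norm_mul, Complex.norm_I, mul_one,
      Complex.norm_real, norm_mul,
      Real.norm_of_nonneg (by positivity : 0 ≤ 2 * Real.pi), Real.norm_eq_abs, norm_one,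
      Complex.norm_natCast, Nat.cast_natAbs, Int.cast_abs]
    exact le_of_eq (by ring)

theorem sum_range_natAbs_sub_le {w : ℕ → ℝ} (hw : ∀ h, 0 ≤ w h) (hw0 : w 0 = 0) {M i : ℕ}
    (hi : i < M) :
    ∑ j ∈ Finset.range M, w ((i : ℤ) - (j : ℤ)).natAbs ≤ 2 * ∑ h ∈ Finset.Icc 1 M, w h := by
  have hsub : ∀ s : Finset ℕ, (∀ j ∈ s, j < M) →
      Set.InjOn (fun j : ℕ => ((i : ℤ) - (j : ℤ)).natAbs) s →
      ∑ j ∈ s, w ((i : ℤ) - (j : ℤ)).natAbs ≤ ∑ h ∈ Finset.Icc 1 M, w h := by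
    intro s hs hinj
    have hext : ∑ h ∈ Finset.Icc 1 M, w h = ∑ h ∈ Finset.range (M + 1), w h := by
      rw [Finset.range_eq_Ico, Finset.sum_eq_sum_Ico_succ_bot (by omega), hw0, zero_add]
      rfl
    rw [hext, ← Finset.sum_image (f := w) hinj]
    refine Finset.sum_le_sum_of_subset_of_nonneg ?_ fun _ _ _ => hw _
    intro h hh
    obtain ⟨j, hj, rfl⟩ := Finset.mem_image.1 hh
    have := hs j hj
    rw [Finset.mem_range]
    omega
  rw [← Finset.sum_filter_add_sum_filter_not (Finset.range M) (fun j => j ≤ i), two_mul]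
  refine add_le_add (hsub _ ?_ ?_) (hsub _ ?_ ?_)
  · intro j hj
    simp at hj
    omega
  · intro a ha b hb hab
    simp at ha hb hab
    omega
  · intro j hj
    simp at hj
    omega
  · intro a ha b hb hab
    simp at ha hb hab
    omega

theorem abs_sawtoothConv_sub_half_le {x : ℕ → ℝ} {N M : ℕ} (hN : 0 < N) (hM : 0 < M) (t : ℝ) :
    |sawtoothConv x N M t - 1 / 2| ≤ 1 / Real.pi * ∑ h ∈ Finset.Icc 1 M,
      1 / (h : ℝ) * (‖∑ k ∈ Finset.Icc 1 N, unitExp (h * x k)‖ / N) := by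
  have hM' : (M : ℂ) ≠ 0 := by exact_mod_cast hM.ne'
  have hMr : (0 : ℝ) < M := by positivity
  have hii : ∀ i ∈ Finset.range M, ∀ j ∈ Finset.range M, IntervalIntegrable
      (fun u : ℝ => (sawtoothMean x N (t - u) : ℂ) * unitExp (((i : ℤ) - (j : ℤ) : ℤ) * u))
      volume (-(1 / 2)) (1 / 2) := by
    intro i _ j _
    have h : IntervalIntegrable (fun u => (sawtoothMean x N (t - u) : ℂ)) volume
        (-(1 / 2)) (1 / 2) := by
      refine (intervalIntegrable_const (c := (1 : ℝ))).mono_fun ?_ ?_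
      · exact (Complex.measurable_ofReal.comp
          ((measurable_sawtoothMean x N).comp (by fun_prop))).aestronglyMeasurable
      · refine Filter.Eventually.of_forall fun u => ?_
        simp only [Complex.norm_real, norm_one]
        rw [Real.norm_of_nonneg (sawtoothMean_nonneg _ _ _)]
        exact sawtoothMean_le_one _ _ _
    exact h.mul_continuousOn (continuous_unitExp.comp (by fun_prop)).continuousOn
  have hexp : ((sawtoothConv x N M t : ℝ) : ℂ) = (1 / (M : ℂ)) * ∑ i ∈ Finset.range M,
      ∑ j ∈ Finset.range M, ∫ u in (-(1 / 2) : ℝ)..(1 / 2),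
        (sawtoothMean x N (t - u) : ℂ) * unitExp (((i : ℤ) - (j : ℤ) : ℤ) * u) := by
    rw [sawtoothConv, ← intervalIntegral.integral_ofReal]
    simp_rw [Complex.ofReal_mul, ofReal_fejerKernel]
    simp_rw [mul_left_comm _ (1 / (M : ℂ)) _]
    rw [intervalIntegral.integral_const_mul]
    congr 1
    simp_rw [Finset.mul_sum]
    rw [intervalIntegral.integral_finsetSum]
    · refine Finset.sum_congr rfl fun i hi => ?_
      rw [intervalIntegral.integral_finsetSum (hii i hi)]
    · intro i hi
      simpa only [Finset.sum_fn] using IntervalIntegrable.sum _ (hii i hi)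
  have hhalf : (1 / 2 : ℂ) = (1 / (M : ℂ)) * ∑ i ∈ Finset.range M, ∑ j ∈ Finset.range M,
      (if ((i : ℤ) - (j : ℤ)) = 0 then 1 / 2 else 0) := by
    have : ∀ i ∈ Finset.range M, ∑ j ∈ Finset.range M,
        (if ((i : ℤ) - (j : ℤ)) = 0 then (1 / 2 : ℂ) else 0) = 1 / 2 := by
      intro i hi
      rw [Finset.sum_eq_single_of_mem i hi]
      · simp
      · intro j _ hj
        rw [if_neg (by omega)]
    rw [Finset.sum_congr rfl this]
    simp [hM']
  set w : ℕ → ℝ := fun h => 1 / (2 * Real.pi * h) *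
    (‖∑ k ∈ Finset.Icc 1 N, unitExp (h * x k)‖ / N) with hw
  have hnorm : |sawtoothConv x N M t - 1 / 2| = ‖((sawtoothConv x N M t : ℝ) : ℂ) - 1 / 2‖ := by
    rw [← Real.norm_eq_abs, ← Complex.norm_real]
    push_cast
    rfl
  rw [hnorm, hexp, hhalf, ← mul_sub, ← Finset.sum_sub_distrib]
  simp_rw [← Finset.sum_sub_distrib]
  have hrow : ∀ i ∈ Finset.range M, ‖∑ j ∈ Finset.range M,
      ((∫ u in (-(1 / 2) : ℝ)..(1 / 2),
        (sawtoothMean x N (t - u) : ℂ) * unitExp (((i : ℤ) - (j : ℤ) : ℤ) * u))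
        - (if ((i : ℤ) - (j : ℤ)) = 0 then 1 / 2 else 0))‖
      ≤ 2 * ∑ h ∈ Finset.Icc 1 M, w h := by
    intro i hi
    refine (norm_sum_le_of_le _ fun (j : ℕ) _ => norm_integral_sawtoothMean_mul_unitExp_le
      (x := x) hN ((i : ℤ) - (j : ℤ)) t).trans ?_
    exact sum_range_natAbs_sub_le (w := w) (fun h => by positivity) (by simp [hw])
      (Finset.mem_range.1 hi)
  calc _ ≤ (1 / (M : ℝ)) * (∑ _i ∈ Finset.range M, 2 * ∑ h ∈ Finset.Icc 1 M, w h) := by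
        rw [norm_mul, norm_div, norm_one, Complex.norm_natCast]
        gcongr
        exact norm_sum_le_of_le _ hrow
    _ = _ := by
        rw [Finset.sum_const, Finset.card_range, nsmul_eq_mul, Finset.mul_sum, Finset.mul_sum,
          Finset.mul_sum, Finset.mul_sum]
        refine Finset.sum_congr rfl fun h hh => ?_
        have : (h : ℝ) ≠ 0 := by
          have := (Finset.mem_Icc.1 hh).1
          positivity
        simp only [hw]
        field_simp

/-- Since the sawtooth average has slope at least `-1`, it stays close to a large value on an
interval to the right of it, and the convolution with the Fejér kernel, which has little mass far
from `0`, is still almost as large. Here `D` bounds the oscillation. -/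
theorem sawtoothMean_le_sawtoothConv {x : ℕ → ℝ} {N M : ℕ} (hM : 0 < M) {D t : ℝ}
    (hD : ∀ a b, sawtoothMean x N b - sawtoothMean x N a ≤ D) (ht : 0 < t) (b : ℝ) :
    sawtoothMean x N b - 2 * t - D * (Real.pi / (2 * M * t)) ≤ sawtoothConv x N M (b + t) ∧
      sawtoothConv x N M (b - t) ≤ sawtoothMean x N b + 2 * t + D * (Real.pi / (2 * M * t)) := by
  have hM' : (0 : ℝ) < M := by positivity
  have hD0 : 0 ≤ D := by simpa using hD 0 0
  have hci : Continuous fun u : ℝ => (u ^ 2 + t ^ 2)⁻¹ :=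
    Continuous.inv₀ (by fun_prop) fun u => by positivity
  have hg : ∫ u in (-(1 / 2) : ℝ)..(1 / 2), D * (1 / (2 * M) * (u ^ 2 + t ^ 2)⁻¹)
      ≤ D * (Real.pi / (2 * M * t)) := by
    rw [intervalIntegral.integral_const_mul, intervalIntegral.integral_const_mul]
    have := integral_inv_sq_add_sq_le ht (-(1 / 2)) (1 / 2)
    calc _ ≤ D * (1 / (2 * M) * (Real.pi / t)) := by gcongr
      _ = _ := by
        field_simp
  have hK := integral_fejerKernel hM
  have hi1 : ∀ c : ℝ, IntervalIntegrable (fun u => c * fejerKernel M u) volume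
      (-(1 / 2)) (1 / 2) := fun c =>
    (continuous_const.mul (continuous_fejerKernel M)).intervalIntegrable _ _
  have hi2 : IntervalIntegrable (fun u : ℝ => D * (1 / (2 * M) * (u ^ 2 + t ^ 2)⁻¹)) volume
      (-(1 / 2)) (1 / 2) :=
    (continuous_const.mul (continuous_const.mul hci)).intervalIntegrable _ _
  constructor
  · have hle : ∫ u in (-(1 / 2) : ℝ)..(1 / 2), ((sawtoothMean x N b - 2 * t) * fejerKernel M u
        - D * (1 / (2 * M) * (u ^ 2 + t ^ 2)⁻¹)) ≤ sawtoothConv x N M (b + t) := by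
      refine intervalIntegral.integral_mono_on (by norm_num) ((hi1 _).sub hi2)
        (intervalIntegrable_sawtoothMean_mul _ _ _ _ _ _) fun u hu => ?_
      have hu' : |u| ≤ 1 / 2 := abs_le.2 ⟨by linarith [hu.1], hu.2⟩
      have h1 : sawtoothMean x N b - 2 * t - D * (if t < |u| then 1 else 0)
          ≤ sawtoothMean x N (b + t - u) := by
        split_ifs with h
        · linarith [hD (b + t - u) b]
        · rw [not_lt, abs_le] at h
          have := sawtoothMean_sub_le x N b (y := t - u) (by linarith)
          rw [show b + (t - u) = b + t - u by ring] at this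
          linarith
      have h2 := mul_le_mul_of_nonneg_right h1 (fejerKernel_nonneg M u)
      have h3 := mul_le_mul_of_nonneg_left (indicator_mul_fejerKernel_le hM ht hu') hD0
      linarith
    rw [intervalIntegral.integral_sub (hi1 _) hi2,
      intervalIntegral.integral_const_mul _ (fejerKernel M), hK] at hle
    linarith
  · have hle : sawtoothConv x N M (b - t) ≤ ∫ u in (-(1 / 2) : ℝ)..(1 / 2),
        ((sawtoothMean x N b + 2 * t) * fejerKernel M u
          + D * (1 / (2 * M) * (u ^ 2 + t ^ 2)⁻¹)) := by
      refine intervalIntegral.integral_mono_on (by norm_num)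
        (intervalIntegrable_sawtoothMean_mul _ _ _ _ _ _) ((hi1 _).add hi2) fun u hu => ?_
      have hu' : |u| ≤ 1 / 2 := abs_le.2 ⟨by linarith [hu.1], hu.2⟩
      have h1 : sawtoothMean x N (b - t - u)
          ≤ sawtoothMean x N b + 2 * t + D * (if t < |u| then 1 else 0) := by
        split_ifs with h
        · linarith [hD b (b - t - u)]
        · rw [not_lt, abs_le] at h
          have := sawtoothMean_sub_le x N (b - t - u) (y := t + u) (by linarith)
          rw [show b - t - u + (t + u) = b by ring] at this
          linarith
      have h2 := mul_le_mul_of_nonneg_right h1 (fejerKernel_nonneg M u)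
      have h3 := mul_le_mul_of_nonneg_left (indicator_mul_fejerKernel_le hM ht hu') hD0
      linarith
    rw [intervalIntegral.integral_add (hi1 _) hi2,
      intervalIntegral.integral_const_mul _ (fejerKernel M), hK] at hle
    linarith

/-- The **Erdős–Turán inequality**, with unoptimized constants. -/
theorem discrepancy_le_erdosTuran (x : ℕ → ℝ) {N M : ℕ} (hN : 0 < N) (hM : 0 < M) :
    discrepancy x N ≤ 16 * Real.pi / M + 4 / Real.pi * ∑ h ∈ Finset.Icc 1 M,
      1 / (h : ℝ) * (‖∑ k ∈ Finset.Icc 1 N, unitExp (h * x k)‖ / N) := by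
  have hM' : (0 : ℝ) < M := by positivity
  have hpi := Real.pi_pos
  set B := ∑ h ∈ Finset.Icc 1 M,
      1 / (h : ℝ) * (‖∑ k ∈ Finset.Icc 1 N, unitExp (h * x k)‖ / N) with hB
  set D : ℝ := ⨆ p : ℝ × ℝ, (sawtoothMean x N p.2 - sawtoothMean x N p.1) with hDdef
  have hbdd : BddAbove (Set.range fun p : ℝ × ℝ =>
      (sawtoothMean x N p.2 - sawtoothMean x N p.1)) := by
    refine ⟨1, ?_⟩
    rintro _ ⟨p, rfl⟩
    linarith [sawtoothMean_le_one x N p.2, sawtoothMean_nonneg x N p.1]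
  have hD : ∀ a b, sawtoothMean x N b - sawtoothMean x N a ≤ D := fun a b =>
    le_ciSup hbdd (a, b)
  -- With `t = 2π / M` the tail of the kernel has mass at most `1 / 4`.
  have ht : 0 < 2 * Real.pi / M := by positivity
  have hτ : Real.pi / (2 * M * (2 * Real.pi / M)) = 1 / 4 := by
    field_simp
    norm_num
  have hstep : D ≤ D / 2 + (8 * Real.pi / M + 2 / Real.pi * B) := by
    refine ciSup_le fun p => ?_
    have h1 := (sawtoothMean_le_sawtoothConv hM hD ht p.2).1
    have h2 := (sawtoothMean_le_sawtoothConv hM hD ht p.1).2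
    have h3 := (abs_le.1 (abs_sawtoothConv_sub_half_le (x := x) hN hM
      (p.2 + 2 * Real.pi / M))).2
    have h4 := (abs_le.1 (abs_sawtoothConv_sub_half_le (x := x) hN hM
      (p.1 - 2 * Real.pi / M))).1
    rw [hτ] at h1 h2
    rw [← hB] at h3 h4
    have e1 : 8 * Real.pi / M = 4 * (2 * Real.pi / M) := by ring
    have e2 : 2 / Real.pi * B = 2 * (1 / Real.pi * B) := by ring
    rw [e1, e2]
    linarith
  have hfin : D ≤ 16 * Real.pi / M + 4 / Real.pi * B := by
    have e1 : 16 * Real.pi / M = 2 * (8 * Real.pi / M) := by ring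
    have e2 : 4 / Real.pi * B = 2 * (2 / Real.pi * B) := by ring
    rw [e1, e2]
    linarith
  refine (csSup_le (discrepancy_set_nonempty x N) ?_).trans hfin
  rintro r ⟨a, b, ha, hab, hb, rfl⟩
  rw [visitFreq_sub_length hN ha hab hb, abs_le]
  exact ⟨by linarith [hD b a], hD a b⟩

/-! ### Sums of negative powers of the distance to the nearest integer -/

theorem distInt_nonneg (t : ℝ) : 0 ≤ distInt t := abs_nonneg _

theorem distInt_le_half (t : ℝ) : distInt t ≤ 1 / 2 := abs_sub_round t

theorem distInt_le_abs_sub (t : ℝ) (z : ℤ) : distInt t ≤ |t - z| := round_le t z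

/-- If `‖qα‖` is smaller than `‖hα‖` with `0 < h < q`, then `‖hα‖ ≥ 1 / (2q)`: otherwise the
integer determinant formed with the numerators nearest to `hα` and `qα` would have absolute value
less than `1`, hence vanish, and the two approximations would coincide. -/
theorem one_div_two_mul_le_distInt {α : ℝ} {h q : ℕ} (hh : 0 < h) (hhq : h < q)
    (hlt : distInt (q * α) < distInt (h * α)) : 1 / (2 * (q : ℝ)) ≤ distInt (h * α) := by
  by_contra! hcon
  have hq : (0 : ℝ) < q := by exact_mod_cast hh.trans hhq
  have hh' : (0 : ℝ) < h := by exact_mod_cast hh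
  have hhq' : (h : ℝ) < q := by exact_mod_cast hhq
  rw [lt_div_iff₀ (by positivity)] at hcon
  have h0 := distInt_nonneg (q * α)
  have habs1 : |(q : ℝ) * (h * α - round (h * α))| = q * distInt (h * α) := by
    rw [abs_mul, abs_of_pos hq, distInt]
  have habs2 : |(h : ℝ) * (q * α - round (q * α))| = h * distInt (q * α) := by
    rw [abs_mul, abs_of_pos hh', distInt]
  have hdet : |((round (q * α) * h - round (h * α) * q : ℤ) : ℝ)| < 1 := by
    have : ((round (q * α) * h - round (h * α) * q : ℤ) : ℝ)
        = (q : ℝ) * (h * α - round (h * α)) - (h : ℝ) * (q * α - round (q * α)) := by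
      push_cast
      ring
    rw [this]
    refine (abs_sub _ _).trans_lt ?_
    rw [habs1, habs2]
    nlinarith
  have hzero : round (q * α) * h - round (h * α) * q = 0 := by
    rw [← Int.abs_lt_one_iff]
    exact_mod_cast hdet
  have hzero' : (round (q * α) : ℝ) * h = round (h * α) * q := by
    exact_mod_cast sub_eq_zero.1 hzero
  have : (q : ℝ) * (h * α - round (h * α)) = (h : ℝ) * (q * α - round (q * α)) := by
    linear_combination hzero'
  rw [this, habs2] at habs1
  nlinarith

/-- Points `hα` which are pairwise `1 / (2q)`-separated modulo `1` are compared with the grid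
`i / (4q)`: a signed cell of that grid contains at most one of them. The cells next to `0` use the
lower bound `δ`. -/
theorem sum_distInt_rpow_le_of_separated {α p δ : ℝ} (hp : 0 ≤ p) (hδ : 0 < δ) {q : ℕ}
    (hq : 0 < q) (B : Finset ℕ)
    (hsep : ∀ h ∈ B, ∀ k ∈ B, h < k → 1 / (2 * (q : ℝ)) ≤ distInt (((k - h : ℕ) : ℝ) * α))
    (hB : ∀ h ∈ B, δ ≤ distInt (h * α)) :
    ∑ h ∈ B, distInt (h * α) ^ (-p) ≤
      2 * (δ ^ (-p) + ∑ i ∈ Finset.Icc 1 (2 * q), ((i : ℝ) / (4 * q)) ^ (-p)) := by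
  have hq' : (0 : ℝ) < q := by exact_mod_cast hq
  set g : ℕ → Bool × ℕ := fun h =>
    (decide (0 ≤ h * α - round (h * α)), ⌊4 * (q : ℝ) * distInt (h * α)⌋₊) with hg
  set G : Bool × ℕ → ℝ := fun x =>
    if x.2 = 0 then δ ^ (-p) else ((x.2 : ℝ) / (4 * q)) ^ (-p) with hG
  have hle : ∀ h ∈ B, distInt (h * α) ^ (-p) ≤ G (g h) := by
    intro h hh
    simp only [hG, hg]
    split_ifs with h0
    · exact Real.rpow_le_rpow_of_nonpos hδ (hB h hh) (by linarith)
    · refine Real.rpow_le_rpow_of_nonpos (by positivity) ?_ (by linarith)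
      rw [div_le_iff₀ (by positivity), mul_comm]
      exact Nat.floor_le (by have := distInt_nonneg (h * α); positivity)
  have hsep' : ∀ h ∈ B, ∀ k ∈ B, h < k → g h ≠ g k := by
    intro h hh k hk hhk heq
    simp only [hg, Prod.mk.injEq, decide_eq_decide] at heq
    obtain ⟨hsgn, hfl⟩ := heq
    have h1 := hsep h hh k hk hhk
    have h2 := distInt_le_abs_sub (((k - h : ℕ) : ℝ) * α) (round (k * α) - round (h * α))
    have h3 : ((k - h : ℕ) : ℝ) * α - ((round (k * α) - round (h * α) : ℤ) : ℝ)
        = (k * α - round (k * α)) - (h * α - round (h * α)) := by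
      rw [Nat.cast_sub hhk.le]
      push_cast
      ring
    rw [h3] at h2
    have hf1 := Nat.floor_le (a := 4 * (q : ℝ) * distInt (h * α))
      (by have := distInt_nonneg (h * α); positivity)
    have hf2 := Nat.lt_floor_add_one (4 * (q : ℝ) * distInt (h * α))
    have hf3 := Nat.floor_le (a := 4 * (q : ℝ) * distInt (k * α))
      (by have := distInt_nonneg (k * α); positivity)
    have hf4 := Nat.lt_floor_add_one (4 * (q : ℝ) * distInt (k * α))
    rw [← hfl] at hf3 hf4
    have h4 : |(k * α - round (k * α)) - (h * α - round (h * α))|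
        = |distInt (k * α) - distInt (h * α)| := by
      unfold distInt
      by_cases hs : 0 ≤ h * α - round (h * α)
      · rw [abs_of_nonneg hs, abs_of_nonneg (hsgn.1 hs)]
      · have hs' : ¬ 0 ≤ k * α - round (k * α) := fun h => hs (hsgn.2 h)
        rw [abs_of_neg (not_le.1 hs), abs_of_neg (not_le.1 hs'), ← abs_neg]
        congr 1
        ring
    rw [h4] at h2
    have h5 : |distInt (k * α) - distInt (h * α)| < 1 / (4 * q) := by
      rw [abs_lt, lt_div_iff₀ (by positivity), ← neg_div, div_lt_iff₀ (by positivity)]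
      constructor <;> nlinarith
    have h6 : 1 / (4 * (q : ℝ)) ≤ 1 / (2 * q) := by
      gcongr
      norm_num
    linarith
  have hinj : Set.InjOn g B := by
    intro h hh k hk heq
    rcases lt_trichotomy h k with hlt | rfl | hlt
    · exact absurd heq (hsep' h hh k hk hlt)
    · rfl
    · exact absurd heq.symm (hsep' k hk h hh hlt)
  calc ∑ h ∈ B, distInt (h * α) ^ (-p) ≤ ∑ h ∈ B, G (g h) := Finset.sum_le_sum hle
    _ = ∑ x ∈ B.image g, G x := (Finset.sum_image hinj).symm
    _ ≤ ∑ x ∈ Finset.univ ×ˢ Finset.range (2 * q + 1), G x := by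
        refine Finset.sum_le_sum_of_subset_of_nonneg ?_ fun x _ _ => ?_
        · intro x hx
          obtain ⟨h, _, rfl⟩ := Finset.mem_image.1 hx
          simp only [hg, Finset.mem_product, Finset.mem_univ, true_and, Finset.mem_range,
            Nat.lt_succ_iff]
          refine Nat.floor_le_of_le ?_
          push_cast
          nlinarith [distInt_le_half (h * α)]
        · simp only [hG]
          split_ifs <;> positivity
    _ = _ := by
        rw [Finset.sum_product]
        simp only [hG, Finset.sum_const, Finset.card_univ, Fintype.card_bool, nsmul_eq_mul,
          Nat.cast_ofNat]
        congr 1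
        rw [Finset.range_eq_Ico, Finset.sum_eq_sum_Ico_succ_bot (by omega), if_pos rfl]
        congr 1
        refine Finset.sum_congr rfl fun i hi => ?_
        rw [if_neg]
        have := (Finset.mem_Ico.1 hi).1
        omega

/-- The integers up to `X` are cut into blocks of length `q`, where `q ≤ X` is the first minimizer
of `‖hα‖` over `1 ≤ h ≤ X`; within each block the points `hα` are separated. -/
theorem exists_sum_distInt_rpow_le {α γ C p : ℝ} (hC : 0 < C) (hp : 0 ≤ p)
    (hdio : ∀ q : ℕ, 0 < q → C * (q : ℝ) ^ (-γ) ≤ distInt (q * α)) {X : ℕ} (hX : 0 < X) :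
    ∃ q : ℕ, 0 < q ∧ q ≤ X ∧ ∑ h ∈ Finset.Icc 1 X, distInt (h * α) ^ (-p) ≤
      4 * X / q * ((C * (q : ℝ) ^ (-γ)) ^ (-p) +
        ∑ i ∈ Finset.Icc 1 (2 * q), ((i : ℝ) / (4 * q)) ^ (-p)) := by
  have hex : ∃ q : ℕ, q ∈ Finset.Icc 1 X ∧
      ∀ h ∈ Finset.Icc 1 X, distInt (q * α) ≤ distInt (h * α) :=
    Finset.exists_min_image (Finset.Icc 1 X) (fun h : ℕ => distInt (h * α))
      ⟨1, Finset.mem_Icc.2 ⟨le_rfl, hX⟩⟩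
  classical
  set q := Nat.find hex with hqdef
  obtain ⟨hq, hqmin⟩ := Nat.find_spec hex
  rw [← hqdef] at hq hqmin
  have hq0 : 0 < q := (Finset.mem_Icc.1 hq).1
  have hqX : q ≤ X := (Finset.mem_Icc.1 hq).2
  have hq' : (0 : ℝ) < q := by exact_mod_cast hq0
  refine ⟨q, hq0, hqX, ?_⟩
  have hrec : ∀ h : ℕ, 0 < h → h < q → distInt (q * α) < distInt (h * α) := by
    intro h hh hhq
    by_contra! hcon
    exact Nat.find_min hex hhq ⟨Finset.mem_Icc.2 ⟨hh, by omega⟩,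
      fun k hk => hcon.trans (hqmin k hk)⟩
  have hδ : 0 < C * (q : ℝ) ^ (-γ) := by positivity
  set U := (C * (q : ℝ) ^ (-γ)) ^ (-p) +
        ∑ i ∈ Finset.Icc 1 (2 * q), ((i : ℝ) / (4 * q)) ^ (-p) with hU
  have hU0 : 0 ≤ U := by positivity
  have hmaps : ∀ h ∈ Finset.Icc 1 X, h / q ∈ Finset.range (X / q + 1) := by
    intro h hh
    rw [Finset.mem_range, Nat.lt_succ_iff]
    exact Nat.div_le_div_right (Finset.mem_Icc.1 hh).2
  rw [← Finset.sum_fiberwise_of_maps_to hmaps]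
  have hblock : ∀ j ∈ Finset.range (X / q + 1),
      ∑ h ∈ Finset.Icc 1 X with h / q = j, distInt (h * α) ^ (-p) ≤ 2 * U := by
    intro j _
    refine sum_distInt_rpow_le_of_separated hp hδ hq0 _ ?_ ?_
    · intro h hh k hk hhk
      have h1 := (Finset.mem_filter.1 hh).2
      have h2 := (Finset.mem_filter.1 hk).2
      have h3 := Nat.div_add_mod h q
      have h4 := Nat.div_add_mod k q
      have h5 := Nat.mod_lt k hq0
      rw [h1] at h3
      rw [h2] at h4
      exact one_div_two_mul_le_distInt (by omega) (by omega) (hrec _ (by omega) (by omega))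
    · intro h hh
      exact (hdio q hq0).trans (hqmin h (Finset.mem_filter.1 hh).1)
  refine (Finset.sum_le_sum hblock).trans ?_
  rw [Finset.sum_const, Finset.card_range, nsmul_eq_mul]
  have hcount : ((X / q + 1 : ℕ) : ℝ) ≤ 2 * X / q := by
    push_cast
    have h1 : ((X / q : ℕ) : ℝ) ≤ X / q := Nat.cast_div_le
    have h2 : (1 : ℝ) ≤ X / q := by
      rw [one_le_div hq']
      exact_mod_cast hqX
    have h3 : 2 * (X : ℝ) / q = X / q + X / q := by ring
    linarith
  calc _ ≤ 2 * (X : ℝ) / q * (2 * U) := by gcongr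
    _ = 4 * X / q * U := by ring

theorem sum_Icc_rpow_sub_one_le {s : ℝ} (hs : 0 < s) (hs1 : s ≤ 1) (n : ℕ) :
    ∑ i ∈ Finset.Icc 1 n, (i : ℝ) ^ (s - 1) ≤ (n : ℝ) ^ s / s := by
  induction n with
  | zero => simp [Real.zero_rpow hs.ne']
  | succ n ih =>
    rw [Finset.sum_Icc_succ_top (by omega)]
    have hn : (0 : ℝ) < n + 1 := by positivity
    have hb : (1 + (-1 / ((n : ℝ) + 1))) ^ s ≤ 1 + s * (-1 / ((n : ℝ) + 1)) := by
      refine rpow_one_add_le_one_add_mul_self ?_ hs.le hs1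
      rw [le_div_iff₀ hn]
      linarith [(Nat.cast_nonneg n : (0 : ℝ) ≤ n)]
    have h1 : 1 + (-1 / ((n : ℝ) + 1)) = n / (n + 1) := by
      field_simp
      ring
    rw [h1, Real.div_rpow (by positivity) hn.le, div_le_iff₀ (by positivity)] at hb
    have h2 : ((n : ℝ) + 1) ^ (s - 1) = (n + 1) ^ s / (n + 1) := by
      rw [Real.rpow_sub hn, Real.rpow_one]
    push_cast
    rw [h2]
    have h3 : (1 + s * (-1 / ((n : ℝ) + 1))) * (n + 1) ^ s
        = (n + 1) ^ s - s * ((n + 1) ^ s / (n + 1)) := by ring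
    rw [h3] at hb
    rw [le_div_iff₀ hs] at ih ⊢
    nlinarith

theorem sum_Icc_one_div_le (n : ℕ) :
    ∑ i ∈ Finset.Icc 1 n, 1 / (i : ℝ) ≤ 1 + Real.log n := by
  have := harmonic_le_one_add_log n
  rw [harmonic_eq_sum_Icc] at this
  push_cast at this
  simpa only [one_div] using this

theorem sum_Icc_rpow_sub_one_le' {s : ℝ} (hs : 0 < s) (n : ℕ) :
    ∑ i ∈ Finset.Icc 1 n, (i : ℝ) ^ (s - 1) ≤ (1 + 1 / s) * (n : ℝ) ^ s := by
  rcases le_total s 1 with h | h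
  · refine (sum_Icc_rpow_sub_one_le hs h n).trans ?_
    have : 0 ≤ (n : ℝ) ^ s := by positivity
    rw [add_mul, one_div_mul_eq_div]
    linarith
  · rcases Nat.eq_zero_or_pos n with rfl | hn
    · simp [Real.zero_rpow hs.ne']
    have hn' : (0 : ℝ) < n := by exact_mod_cast hn
    calc _ ≤ ∑ _i ∈ Finset.Icc 1 n, (n : ℝ) ^ (s - 1) := by
          refine Finset.sum_le_sum fun i hi => ?_
          have : (i : ℝ) ≤ n := by exact_mod_cast (Finset.mem_Icc.1 hi).2
          exact Real.rpow_le_rpow (by positivity) this (by linarith)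
      _ = (n : ℝ) ^ s := by
          rw [Finset.sum_const, Nat.card_Icc, Nat.add_sub_cancel, nsmul_eq_mul,
            Real.rpow_sub hn', Real.rpow_one]
          field_simp
      _ ≤ _ := by
          have h1 : 0 < 1 / s := by positivity
          have : 0 ≤ (n : ℝ) ^ s := by positivity
          nlinarith

/-- Partial summation. -/
theorem sum_div_le_of_sum_le {a g : ℕ → ℝ} (hg0 : ∀ n, 0 ≤ g n) (hg : Monotone g)
    (h : ∀ X, ∑ i ∈ Finset.Icc 1 X, a i ≤ X * g X) (H : ℕ) :
    ∑ i ∈ Finset.Icc 1 H, 1 / (i : ℝ) * a i ≤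
      g H + ∑ i ∈ Finset.Icc 1 H, g i / i := by
  have key : ∀ H : ℕ, ∑ i ∈ Finset.Icc 1 H, 1 / (i : ℝ) * a i ≤
      (1 / (H : ℝ)) * ∑ i ∈ Finset.Icc 1 H, a i + ∑ i ∈ Finset.Icc 1 H, g i / i := by
    intro H
    induction H with
    | zero => simp
    | succ n ih =>
      rw [Finset.sum_Icc_succ_top (by omega), Finset.sum_Icc_succ_top (by omega),
        Finset.sum_Icc_succ_top (by omega)]
      have h1 : (1 / (n : ℝ) - 1 / ((n : ℝ) + 1)) * ∑ i ∈ Finset.Icc 1 n, a i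
          ≤ g (n + 1) / (n + 1) := by
        rcases Nat.eq_zero_or_pos n with rfl | hn
        · simp [hg0]
        have hn' : (0 : ℝ) < n := by exact_mod_cast hn
        have h2 : (1 / (n : ℝ) - 1 / ((n : ℝ) + 1)) = 1 / (n * (n + 1)) := by
          field_simp
          ring
        rw [h2]
        calc _ ≤ 1 / ((n : ℝ) * (n + 1)) * (n * g (n + 1)) := by
              have := hg (Nat.le_succ n)
              have := h n
              gcongr
              refine this.trans ?_
              gcongr
          _ = _ := by field_simp
      push_cast at h1 ⊢
      linarith
  refine (key H).trans ?_
  gcongr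
  rcases Nat.eq_zero_or_pos H with rfl | hH
  · simp [hg0]
  have hH' : (0 : ℝ) < H := by exact_mod_cast hH
  rw [one_div_mul_eq_div, div_le_iff₀ hH', mul_comm]
  exact h H

theorem sum_Icc_div_rpow_neg_le {p : ℝ} (hp : 0 < p) (hp1 : p < 1) {q : ℕ} (hq : 0 < q) :
    ∑ i ∈ Finset.Icc 1 (2 * q), ((i : ℝ) / (4 * q)) ^ (-p) ≤ 4 / (1 - p) * q := by
  have hq' : (0 : ℝ) < q := by exact_mod_cast hq
  have h1 : ∀ i ∈ Finset.Icc 1 (2 * q), ((i : ℝ) / (4 * q)) ^ (-p)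
      = (4 * q) ^ p * (i : ℝ) ^ ((1 - p) - 1) := by
    intro i _
    rw [Real.div_rpow (by positivity) (by positivity),
      Real.rpow_neg (by positivity : (0 : ℝ) ≤ 4 * q),
      div_inv_eq_mul, mul_comm]
    congr 2
    ring
  rw [Finset.sum_congr rfl h1, ← Finset.mul_sum]
  have h2 := sum_Icc_rpow_sub_one_le (s := 1 - p) (by linarith) (by linarith) (2 * q)
  have h3 : ((2 * q : ℕ) : ℝ) ^ (1 - p) ≤ (4 * q) ^ (1 - p) := by
    push_cast
    refine Real.rpow_le_rpow (by positivity) (by linarith) (by linarith)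
  have h4 : (0 : ℝ) < 1 - p := by linarith
  calc _ ≤ (4 * (q : ℝ)) ^ p * ((4 * q) ^ (1 - p) / (1 - p)) := by
        gcongr
        refine h2.trans ?_
        gcongr
    _ = 4 / (1 - p) * q := by
        rw [← mul_div_assoc, ← Real.rpow_add (by positivity)]
        have : p + (1 - p) = 1 := by ring
        rw [this, Real.rpow_one]
        ring

theorem sum_Icc_div_rpow_neg_one_le {q : ℕ} (hq : 0 < q) :
    ∑ i ∈ Finset.Icc 1 (2 * q), ((i : ℝ) / (4 * q)) ^ (-(1 : ℝ)) ≤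
      8 * q * (1 + Real.log q) := by
  have hq' : (0 : ℝ) < q := by exact_mod_cast hq
  have hlog : 0 ≤ Real.log q := Real.log_natCast_nonneg q
  have h1 : ∀ i ∈ Finset.Icc 1 (2 * q), ((i : ℝ) / (4 * q)) ^ (-(1 : ℝ))
      = 4 * q * (1 / (i : ℝ)) := by
    intro i _
    rw [Real.rpow_neg_one, inv_div]
    ring
  rw [Finset.sum_congr rfl h1, ← Finset.mul_sum]
  have h2 := sum_Icc_one_div_le (2 * q)
  push_cast at h2
  rw [Real.log_mul (by norm_num) hq'.ne'] at h2
  have h3 : Real.log 2 ≤ 1 := by linarith [Real.log_two_lt_d9]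
  calc _ ≤ 4 * (q : ℝ) * (2 * (1 + Real.log q)) := by
        gcongr
        linarith
    _ = _ := by ring

theorem mul_rpow_neg_rpow_neg {C γ p : ℝ} (hC : 0 < C) {q : ℕ} (hq : 0 < q) :
    (C * (q : ℝ) ^ (-γ)) ^ (-p) = C ^ (-p) * q * (q : ℝ) ^ (γ * p - 1) := by
  have hq' : (0 : ℝ) < q := by exact_mod_cast hq
  rw [Real.mul_rpow hC.le (by positivity), ← Real.rpow_mul hq'.le, Real.rpow_sub hq',
    Real.rpow_one]
  field_simp

/-- The subcritical case: the sum of `‖hα‖ ^ (-p) / h` over `h ≤ H` is `O(log H)`. -/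
theorem exists_weightedSum_le_log {α γ C p : ℝ} (hC : 0 < C)
    (hdio : ∀ q : ℕ, 0 < q → C * (q : ℝ) ^ (-γ) ≤ distInt (q * α)) (hp : 0 < p) (hp1 : p < 1)
    (hγp : γ * p ≤ 1) : ∃ K : ℝ, 0 < K ∧ ∀ H : ℕ,
      ∑ h ∈ Finset.Icc 1 H, 1 / (h : ℝ) * distInt (h * α) ^ (-p) ≤ K * (1 + Real.log H) := by
  have h1p : 0 < 1 - p := by linarith
  set K₀ : ℝ := 4 * (C ^ (-p) + 4 / (1 - p)) with hK₀
  have hK₀pos : 0 < K₀ := by positivity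
  have hS : ∀ X : ℕ, ∑ h ∈ Finset.Icc 1 X, distInt (h * α) ^ (-p) ≤ X * K₀ := by
    intro X
    rcases Nat.eq_zero_or_pos X with rfl | hX
    · simp
    obtain ⟨q, hq, hqX, h⟩ := exists_sum_distInt_rpow_le hC hp.le hdio hX
    have hq' : (0 : ℝ) < q := by exact_mod_cast hq
    have hq1 : (1 : ℝ) ≤ q := by exact_mod_cast hq
    refine h.trans ?_
    rw [mul_rpow_neg_rpow_neg hC hq]
    have h1 := sum_Icc_div_rpow_neg_le hp hp1 hq
    have h2 : (q : ℝ) ^ (γ * p - 1) ≤ 1 := Real.rpow_le_one_of_one_le_of_nonpos hq1 (by linarith)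
    calc _ ≤ 4 * (X : ℝ) / q * (C ^ (-p) * q * 1 + 4 / (1 - p) * q) := by gcongr
      _ = X * K₀ := by
        rw [hK₀]
        field_simp
  refine ⟨2 * K₀, by positivity, fun H => ?_⟩
  refine (sum_div_le_of_sum_le (g := fun _ => K₀) (fun _ => hK₀pos.le) monotone_const hS H).trans ?_
  have h1 := sum_Icc_one_div_le H
  have h2 : ∑ i ∈ Finset.Icc 1 H, K₀ / (i : ℝ) = K₀ * ∑ i ∈ Finset.Icc 1 H, 1 / (i : ℝ) := by
    rw [Finset.mul_sum]
    exact Finset.sum_congr rfl fun i _ => by ring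
  have h3 := Real.log_natCast_nonneg H
  rw [h2]
  nlinarith

/-- The critical case `p = 1`, `γ = 1`: the sum is `O(log² H)`. -/
theorem exists_weightedSum_le_log_sq {α γ C : ℝ} (hC : 0 < C)
    (hdio : ∀ q : ℕ, 0 < q → C * (q : ℝ) ^ (-γ) ≤ distInt (q * α)) (hγ : γ ≤ 1) :
    ∃ K : ℝ, 0 < K ∧ ∀ H : ℕ,
      ∑ h ∈ Finset.Icc 1 H, 1 / (h : ℝ) * distInt (h * α) ^ (-(1 : ℝ)) ≤
        K * (1 + Real.log H) ^ 2 := by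
  set K₀ : ℝ := 4 * (C ^ (-(1 : ℝ)) + 8) with hK₀
  have hK₀pos : 0 < K₀ := by positivity
  have hlog : ∀ n : ℕ, 0 ≤ Real.log n := Real.log_natCast_nonneg
  have hmono : ∀ m n : ℕ, m ≤ n → Real.log m ≤ Real.log n := by
    intro m n hmn
    rcases Nat.eq_zero_or_pos m with rfl | hm
    · simpa using hlog n
    · exact Real.log_le_log (by exact_mod_cast hm) (by exact_mod_cast hmn)
  have hS : ∀ X : ℕ, ∑ h ∈ Finset.Icc 1 X, distInt (h * α) ^ (-(1 : ℝ)) ≤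
      X * (K₀ * (1 + Real.log X)) := by
    intro X
    rcases Nat.eq_zero_or_pos X with rfl | hX
    · simp
    obtain ⟨q, hq, hqX, h⟩ := exists_sum_distInt_rpow_le hC zero_le_one hdio hX
    have hq' : (0 : ℝ) < q := by exact_mod_cast hq
    have hq1 : (1 : ℝ) ≤ q := by exact_mod_cast hq
    refine h.trans ?_
    rw [mul_rpow_neg_rpow_neg hC hq]
    have h1 := sum_Icc_div_rpow_neg_one_le hq
    have h2 : (q : ℝ) ^ (γ * 1 - 1) ≤ 1 := Real.rpow_le_one_of_one_le_of_nonpos hq1 (by linarith)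
    have h3 := hmono q X hqX
    have h4 := hlog X
    calc _ ≤ 4 * (X : ℝ) / q * (C ^ (-(1 : ℝ)) * q * (1 + Real.log X)
          + 8 * q * (1 + Real.log X)) := by
          gcongr
          · linarith
          · refine h1.trans ?_
            gcongr
      _ = X * (K₀ * (1 + Real.log X)) := by
        rw [hK₀]
        field_simp
  refine ⟨2 * K₀, by positivity, fun H => ?_⟩
  refine (sum_div_le_of_sum_le (g := fun X => K₀ * (1 + Real.log X)) (fun n => ?_) ?_ hS H).trans ?_
  · have := hlog n
    positivity
  · intro m n hmn
    have := hmono m n hmn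
    simp only
    gcongr
  have h1 := sum_Icc_one_div_le H
  have h3 := hlog H
  have h2 : ∑ i ∈ Finset.Icc 1 H, K₀ * (1 + Real.log i) / (i : ℝ)
      ≤ K₀ * (1 + Real.log H) * ∑ i ∈ Finset.Icc 1 H, 1 / (i : ℝ) := by
    rw [Finset.mul_sum]
    refine Finset.sum_le_sum fun i hi => ?_
    have := hmono i H (Finset.mem_Icc.1 hi).2
    rw [mul_one_div]
    gcongr
  have h4 : K₀ * (1 + Real.log H) * ∑ i ∈ Finset.Icc 1 H, 1 / (i : ℝ)
      ≤ K₀ * (1 + Real.log H) * (1 + Real.log H) := by gcongr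
  have h5 : K₀ * (1 + Real.log H) * 1 ≤ K₀ * (1 + Real.log H) * (1 + Real.log H) := by
    gcongr
    linarith
  have h6 : 2 * K₀ * (1 + Real.log H) ^ 2 = 2 * (K₀ * (1 + Real.log H) * (1 + Real.log H)) := by
    ring
  rw [h6]
  linarith

/-- The supercritical case `γp > 1`, in which the single best approximation dominates. -/
theorem exists_weightedSum_le_rpow {α γ C p : ℝ} (hC : 0 < C)
    (hdio : ∀ q : ℕ, 0 < q → C * (q : ℝ) ^ (-γ) ≤ distInt (q * α)) (hp : 0 < p) (hp1 : p ≤ 1)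
    (hγp : 1 < γ * p) : ∃ K : ℝ, 0 < K ∧ ∀ H : ℕ,
      ∑ h ∈ Finset.Icc 1 H, 1 / (h : ℝ) * distInt (h * α) ^ (-p) ≤
        K * (H : ℝ) ^ (γ * p - 1) := by
  set s := γ * p - 1 with hs
  have hs0 : 0 < s := by linarith
  have hmono : ∀ m n : ℕ, m ≤ n → (m : ℝ) ^ s ≤ (n : ℝ) ^ s := fun m n hmn =>
    Real.rpow_le_rpow (by positivity) (by exact_mod_cast hmn) hs0.le
  obtain ⟨K₁, hK₁, hgrid⟩ : ∃ K₁ : ℝ, 0 < K₁ ∧ ∀ q : ℕ, 0 < q →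
      ∑ i ∈ Finset.Icc 1 (2 * q), ((i : ℝ) / (4 * q)) ^ (-p) ≤ K₁ * q * (q : ℝ) ^ s := by
    rcases hp1.lt_or_eq with hlt | rfl
    · have h1p : 0 < 1 - p := by linarith
      refine ⟨4 / (1 - p), by positivity, fun q hq => (sum_Icc_div_rpow_neg_le hp hlt hq).trans ?_⟩
      have hq1 : (1 : ℝ) ≤ q := by exact_mod_cast hq
      exact le_mul_of_one_le_right (by positivity) (Real.one_le_rpow hq1 hs0.le)
    · refine ⟨8 * (1 + 1 / s), by positivity, fun q hq =>
        (sum_Icc_div_rpow_neg_one_le hq).trans ?_⟩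
      have hq1 : (1 : ℝ) ≤ q := by exact_mod_cast hq
      have h1 := Real.log_le_rpow_div (by positivity : (0 : ℝ) ≤ q) hs0
      have h2 := Real.one_le_rpow hq1 hs0.le
      calc 8 * (q : ℝ) * (1 + Real.log q) ≤ 8 * q * ((q : ℝ) ^ s + (q : ℝ) ^ s / s) := by gcongr
        _ = _ := by ring
  set K₀ : ℝ := 4 * (C ^ (-p) + K₁) with hK₀
  have hK₀pos : 0 < K₀ := by positivity
  have hS : ∀ X : ℕ, ∑ h ∈ Finset.Icc 1 X, distInt (h * α) ^ (-p) ≤ X * (K₀ * (X : ℝ) ^ s) := by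
    intro X
    rcases Nat.eq_zero_or_pos X with rfl | hX
    · simp
    obtain ⟨q, hq, hqX, h⟩ := exists_sum_distInt_rpow_le hC hp.le hdio hX
    have hq' : (0 : ℝ) < q := by exact_mod_cast hq
    refine h.trans ?_
    rw [mul_rpow_neg_rpow_neg hC hq]
    have h1 := hgrid q hq
    have h2 := hmono q X hqX
    calc _ ≤ 4 * (X : ℝ) / q * (C ^ (-p) * q * (X : ℝ) ^ s + K₁ * q * (X : ℝ) ^ s) := by
          gcongr
          refine h1.trans ?_
          gcongr
      _ = X * (K₀ * (X : ℝ) ^ s) := by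
        rw [hK₀]
        field_simp
  refine ⟨K₀ * (2 + 1 / s), by positivity, fun H => ?_⟩
  refine (sum_div_le_of_sum_le (g := fun X => K₀ * (X : ℝ) ^ s) (fun n => by positivity) ?_
    hS H).trans ?_
  · intro m n hmn
    have := hmono m n hmn
    simp only
    gcongr
  have h2 : ∑ i ∈ Finset.Icc 1 H, K₀ * (i : ℝ) ^ s / (i : ℝ)
      = K₀ * ∑ i ∈ Finset.Icc 1 H, (i : ℝ) ^ (s - 1) := by
    rw [Finset.mul_sum]
    refine Finset.sum_congr rfl fun i hi => ?_
    have : (0 : ℝ) < i := by exact_mod_cast (Finset.mem_Icc.1 hi).1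
    rw [Real.rpow_sub this s 1, Real.rpow_one]
    ring
  have h3 := mul_le_mul_of_nonneg_left (sum_Icc_rpow_sub_one_le' hs0 H) hK₀pos.le
  rw [h2]
  have h4 : K₀ * (2 + 1 / s) * (H : ℝ) ^ s
      = K₀ * (H : ℝ) ^ s + K₀ * ((1 + 1 / s) * (H : ℝ) ^ s) := by ring
  rw [h4]
  linarith

/-! ### The martingale attached to one frequency -/

/-- The filtration whose `n`-th term is generated by the first `n` steps `X 0, …, X (n - 1)`. -/
def stepFiltration {Ω : Type*} [mΩ : MeasurableSpace Ω] {X : ℕ → Ω → ℝ}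
    (hX : ∀ j, Measurable (X j)) : Filtration ℕ mΩ where
  seq n := ⨆ j ∈ Set.Iio n, MeasurableSpace.comap (X j) inferInstance
  mono' _ _ h := biSup_mono fun _ hj => lt_of_lt_of_le hj h
  le' _ := iSup₂_le fun j _ => (hX j).comap_le

/-- The sum of the differences `e(y S_{k+1}) - z e(y S_k)` for `k < n`, written as a martingale
transform of the centred variables `e(y X_k) - z`, where `z` is the mean of `e(y X_k)`. -/
noncomputable def walkMartingale {Ω : Type*} (X : ℕ → Ω → ℝ) (z : ℂ) (y : ℝ) (n : ℕ) (ω : Ω) : ℂ :=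
  ∑ k ∈ Finset.range n, unitExp (y * randomWalk X k ω) * (unitExp (y * X k ω) - z)

theorem randomWalk_succ {Ω : Type*} (X : ℕ → Ω → ℝ) (n : ℕ) (ω : Ω) :
    randomWalk X (n + 1) ω = randomWalk X n ω + X n ω := Finset.sum_range_succ _ _

theorem walkMartingale_succ {Ω : Type*} (X : ℕ → Ω → ℝ) (z : ℂ) (y : ℝ) (n : ℕ) (ω : Ω) :
    walkMartingale X z y (n + 1) ω = walkMartingale X z y n ω +
      unitExp (y * randomWalk X n ω) * (unitExp (y * X n ω) - z) := Finset.sum_range_succ _ _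

/-- The discrete Poisson equation: up to a bounded error, the exponential sum of the walk is
`(1 - z)⁻¹` times a martingale. -/
theorem one_sub_mul_sum_unitExp {Ω : Type*} (X : ℕ → Ω → ℝ) (z : ℂ) (y : ℝ) (n : ℕ) (ω : Ω) :
    (1 - z) * ∑ k ∈ Finset.Icc 1 n, unitExp (y * randomWalk X k ω) =
      walkMartingale X z y n ω + z - z * unitExp (y * randomWalk X n ω) := by
  induction n with
  | zero => simp [walkMartingale, randomWalk, unitExp_zero]
  | succ n ih =>
    rw [Finset.sum_Icc_succ_top (by omega), mul_add, ih, walkMartingale_succ, randomWalk_succ,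
      mul_add y, unitExp_add]
    ring

theorem norm_sum_unitExp_randomWalk_le {Ω : Type*} (X : ℕ → Ω → ℝ) {z : ℂ} (hz : ‖z‖ ≤ 1) (y : ℝ)
    (n : ℕ) (ω : Ω) :
    ‖1 - z‖ * ‖∑ k ∈ Finset.Icc 1 n, unitExp (y * randomWalk X k ω)‖ ≤
      ‖walkMartingale X z y n ω‖ + 2 := by
  rw [← norm_mul, one_sub_mul_sum_unitExp]
  refine (norm_sub_le _ _).trans ?_
  have h1 := norm_add_le (walkMartingale X z y n ω) z
  rw [norm_mul, norm_unitExp]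
  linarith

theorem norm_walkMartingale_le {Ω : Type*} (X : ℕ → Ω → ℝ) {z : ℂ} (hz : ‖z‖ ≤ 1) (y : ℝ)
    (n : ℕ) (ω : Ω) : ‖walkMartingale X z y n ω‖ ≤ 2 * n := by
  refine (norm_sum_le_of_le (f := fun k => unitExp (y * randomWalk X k ω) *
    (unitExp (y * X k ω) - z)) (n := fun _ => (2 : ℝ)) _ fun k _ => ?_).trans ?_
  · rw [norm_mul, norm_unitExp, one_mul]
    refine (norm_sub_le _ _).trans ?_
    rw [norm_unitExp]
    linarith
  · rw [Finset.sum_const, Finset.card_range, nsmul_eq_mul, mul_comm]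

/-- The process `exp(l · Re(u M_n))` attached to the martingale and the direction `u`. -/
noncomputable def expOfMartingale {Ω : Type*} (X : ℕ → Ω → ℝ) (z : ℂ) (y l : ℝ) (u : ℂ) (n : ℕ)
    (ω : Ω) : ℝ :=
  Real.exp (l * (u * walkMartingale X z y n ω).re)

theorem expOfMartingale_pos {Ω : Type*} {X : ℕ → Ω → ℝ} {z : ℂ} {y l : ℝ} {u : ℂ} (n : ℕ)
    (ω : Ω) : 0 < expOfMartingale X z y l u n ω := Real.exp_pos _

theorem expOfMartingale_succ {Ω : Type*} {X : ℕ → Ω → ℝ} {z : ℂ} {y l : ℝ} {u : ℂ} (n : ℕ) (ω : Ω) :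
    expOfMartingale X z y l u (n + 1) ω = expOfMartingale X z y l u n ω *
      Real.exp (l * (u * (unitExp (y * randomWalk X n ω) * (unitExp (y * X n ω) - z))).re) := by
  rw [expOfMartingale, expOfMartingale, ← Real.exp_add, walkMartingale_succ,
    mul_add, Complex.add_re, mul_add]

theorem norm_expOfMartingale_le {Ω : Type*} {X : ℕ → Ω → ℝ} {z : ℂ} {y l : ℝ} {u : ℂ}
    (hz1 : ‖z‖ ≤ 1) (hu : ‖u‖ = 1) (hl : 0 ≤ l) (n : ℕ) (ω : Ω) :
    ‖expOfMartingale X z y l u n ω‖ ≤ Real.exp (l * (2 * n)) := by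
  rw [Real.norm_of_nonneg (expOfMartingale_pos n ω).le, expOfMartingale]
  have h1 := Complex.re_le_norm (u * walkMartingale X z y n ω)
  rw [norm_mul, hu, one_mul] at h1
  have h2 := norm_walkMartingale_le X hz1 y n ω
  gcongr
  exact h1.trans h2

section Probability

variable {Ω : Type*} [mΩ : MeasurableSpace Ω] {P : Measure Ω}
  {X : ℕ → Ω → ℝ} {z : ℂ} {y l : ℝ} {u : ℂ}

theorem measurable_step_stepFiltration (hX : ∀ j, Measurable (X j)) {j n : ℕ} (h : j < n) :
    Measurable[stepFiltration hX n] (X j) :=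
  (comap_measurable (X j)).mono
    (le_iSup₂_of_le (f := fun j (_ : j ∈ Set.Iio n) =>
      MeasurableSpace.comap (X j) inferInstance) j h le_rfl) le_rfl

theorem measurable_randomWalk_stepFiltration (hX : ∀ j, Measurable (X j)) {j n : ℕ} (h : j ≤ n) :
    Measurable[stepFiltration hX n] (randomWalk X j) := by
  unfold randomWalk
  exact Finset.measurable_sum _ fun i hi =>
    measurable_step_stepFiltration hX ((Finset.mem_range.1 hi).trans_le h)

theorem measurable_walkMartingale_stepFiltration (hX : ∀ j, Measurable (X j)) (n : ℕ) :
    Measurable[stepFiltration hX n] (walkMartingale X z y n) := by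
  unfold walkMartingale
  refine Finset.measurable_sum _ fun i hi => ?_
  have hi' := Finset.mem_range.1 hi
  refine Measurable.mul ?_ (Measurable.sub_const ?_ _)
  · exact continuous_unitExp.measurable.comp
      ((measurable_randomWalk_stepFiltration hX hi'.le).const_mul y)
  · exact continuous_unitExp.measurable.comp
      ((measurable_step_stepFiltration hX hi').const_mul y)

theorem measurable_expOfMartingale_stepFiltration (hX : ∀ j, Measurable (X j)) (n : ℕ) :
    Measurable[stepFiltration hX n] (expOfMartingale X z y l u n) := by
  unfold expOfMartingale
  exact Real.measurable_exp.comp ((Complex.measurable_re.comp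
    ((measurable_walkMartingale_stepFiltration hX n).const_mul u)).const_mul l)

theorem indepFun_stepFiltration (hX : ∀ j, Measurable (X j)) (hindep : iIndepFun X P) {n : ℕ}
    {E F : Type*} [MeasurableSpace E] [MeasurableSpace F] {f : Ω → E} {g : ℝ → F}
    (hf : Measurable[stepFiltration hX n] f) (hg : Measurable g) :
    IndepFun f (fun ω => g (X n ω)) P := by
  have h := indep_iSup_of_disjoint (m := fun j => MeasurableSpace.comap (X j) inferInstance)
    (fun j => (hX j).comap_le) hindep (S := Set.Iio n) (T := {n}) (by simp)
  simp only [Set.mem_singleton_iff, iSup_iSup_eq_left] at h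
  have h2 : Indep (MeasurableSpace.comap f inferInstance)
      (MeasurableSpace.comap (fun ω => g (X n ω)) inferInstance) P := by
    refine indep_of_indep_of_le_left (indep_of_indep_of_le_right h ?_) hf.comap_le
    exact (hg.comp (comap_measurable (X n))).comap_le
  exact h2

theorem submartingale_sum {ι : Type*} {ℱ : Filtration ℕ mΩ} [IsFiniteMeasure P] (s : Finset ι)
    {f : ι → ℕ → Ω → ℝ} (hf : ∀ i ∈ s, Submartingale (f i) ℱ P) :
    Submartingale (∑ i ∈ s, f i) ℱ P := by
  classical
  induction s using Finset.induction_on with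
  | empty =>
    rw [Finset.sum_empty]
    exact (martingale_zero ℝ ℱ P).submartingale
  | insert a s ha ih =>
    rw [Finset.sum_insert ha]
    exact (hf a (Finset.mem_insert_self a s)).add
      (ih fun i hi => hf i (Finset.mem_insert_of_mem hi))

variable [IsProbabilityMeasure P]

theorem integrable_of_measurable_of_bound {E : Type*} [NormedAddCommGroup E] [MeasurableSpace E]
    [BorelSpace E] [SecondCountableTopology E] {f : Ω → E} (hf : Measurable f) (B : ℝ)
    (hB : ∀ ω, ‖f ω‖ ≤ B) : Integrable f P :=
  Integrable.of_bound hf.aestronglyMeasurable B (Filter.Eventually.of_forall hB)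

theorem norm_unitExp_sub_le (hz1 : ‖z‖ ≤ 1) (x : ℝ) : ‖unitExp x - z‖ ≤ 2 := by
  refine (norm_sub_le _ _).trans ?_
  rw [norm_unitExp]
  linarith

theorem norm_increment_le (hz1 : ‖z‖ ≤ 1) (hu : ‖u‖ = 1) (a x : ℝ) :
    ‖u * (unitExp a * (unitExp x - z))‖ ≤ 2 := by
  rw [norm_mul, norm_mul, norm_unitExp, hu, one_mul, one_mul]
  exact norm_unitExp_sub_le hz1 x

theorem integral_mul_increment_re (hX : ∀ j, Measurable (X j)) (hindep : iIndepFun X P)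
    (hz : ∀ n, ∫ ω, unitExp (y * X n ω) ∂P = z) {n : ℕ} {W : Ω → ℝ}
    (hW : Measurable[stepFiltration hX n] W) (B : ℝ) (hB : ∀ ω, ‖W ω‖ ≤ B) :
    ∫ ω, W ω * (u * (unitExp (y * randomWalk X n ω) * (unitExp (y * X n ω) - z))).re ∂P = 0 := by
  have hle := (stepFiltration hX).le n
  have hYm : Measurable fun x : ℝ => unitExp (y * x) - z :=
    (continuous_unitExp.measurable.comp (measurable_id.const_mul y)).sub_const z
  have hFm : Measurable[stepFiltration hX n]
      fun ω => (W ω : ℂ) * (u * unitExp (y * randomWalk X n ω)) := by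
    refine (Complex.measurable_ofReal.comp hW).mul (Measurable.const_mul ?_ u)
    exact continuous_unitExp.measurable.comp
      ((measurable_randomWalk_stepFiltration hX le_rfl).const_mul y)
  have hind := indepFun_stepFiltration hX hindep hFm hYm
  have hprod := hind.integral_fun_mul_eq_mul_integral
    (hFm.mono hle le_rfl).aestronglyMeasurable (hYm.comp (hX n)).aestronglyMeasurable
  have hint1 : Integrable (fun ω => unitExp (y * X n ω)) P :=
    integrable_of_measurable_of_bound
      (continuous_unitExp.measurable.comp ((hX n).const_mul y)) 1 fun ω => (norm_unitExp _).le
  have hmean : ∫ ω, (unitExp (y * X n ω) - z) ∂P = 0 := by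
    rw [integral_sub hint1 (integrable_const z), hz n]
    simp
  rw [hmean, mul_zero] at hprod
  have hint : Integrable (fun ω => ((W ω : ℂ) * (u * unitExp (y * randomWalk X n ω))) *
      (unitExp (y * X n ω) - z)) P := by
    refine integrable_of_measurable_of_bound
      ((hFm.mono hle le_rfl).mul (hYm.comp (hX n))) (B * ‖u‖ * (1 + ‖z‖)) fun ω => ?_
    rw [norm_mul, norm_mul, norm_mul, norm_unitExp, mul_one, Complex.norm_real]
    have h1 : ‖unitExp (y * X n ω) - z‖ ≤ 1 + ‖z‖ := by
      refine (norm_sub_le _ _).trans ?_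
      rw [norm_unitExp]
    have h2 := hB ω
    have h3 : 0 ≤ B := (norm_nonneg _).trans h2
    gcongr
  have hre := integral_re hint
  rw [hprod] at hre
  rw [← map_zero (RCLike.re : ℂ →+ ℝ), ← hre]
  refine integral_congr_ae (Filter.Eventually.of_forall fun ω => ?_)
  simp only [RCLike.re_to_complex]
  rw [← Complex.re_ofReal_mul]
  congr 1
  ring

theorem integral_norm_unitExp_sub_sq (hX : ∀ j, Measurable (X j)) {n : ℕ}
    (hz : ∫ ω, unitExp (y * X n ω) ∂P = z) :
    ∫ ω, ‖unitExp (y * X n ω) - z‖ ^ 2 ∂P = 1 - ‖z‖ ^ 2 := by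
  have hint1 : Integrable (fun ω => unitExp (y * X n ω)) P :=
    integrable_of_measurable_of_bound
      (continuous_unitExp.measurable.comp ((hX n).const_mul y)) 1 fun ω => (norm_unitExp _).le
  have hint2 : Integrable (fun ω => (starRingEnd ℂ) z * unitExp (y * X n ω)) P :=
    hint1.const_mul _
  have hexp : ∀ ω, ‖unitExp (y * X n ω) - z‖ ^ 2 =
      (1 + ‖z‖ ^ 2) - 2 * RCLike.re ((starRingEnd ℂ) z * unitExp (y * X n ω)) := by
    intro ω
    rw [← Complex.normSq_eq_norm_sq, Complex.normSq_sub, Complex.normSq_eq_norm_sq,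
      Complex.normSq_eq_norm_sq, norm_unitExp, mul_comm ((starRingEnd ℂ) z)]
    simp
  simp_rw [hexp]
  rw [integral_sub (integrable_const _) (hint2.re.const_mul 2), integral_const_mul,
    integral_re hint2, integral_const_mul, hz, ← Complex.normSq_eq_conj_mul_self,
    RCLike.re_to_complex, Complex.ofReal_re, Complex.normSq_eq_norm_sq, integral_const,
    probReal_univ, one_smul]
  ring

theorem integral_mul_increment_re_sq_le (hX : ∀ j, Measurable (X j)) (hindep : iIndepFun X P)
    (hz : ∀ n, ∫ ω, unitExp (y * X n ω) ∂P = z) (hz1 : ‖z‖ ≤ 1) (hu : ‖u‖ = 1) {n : ℕ}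
    {W : Ω → ℝ} (hW : Measurable[stepFiltration hX n] W) (hW0 : ∀ ω, 0 ≤ W ω) (B : ℝ)
    (hB : ∀ ω, ‖W ω‖ ≤ B) :
    ∫ ω, W ω * (u * (unitExp (y * randomWalk X n ω) * (unitExp (y * X n ω) - z))).re ^ 2 ∂P ≤
      (1 - ‖z‖ ^ 2) * ∫ ω, W ω ∂P := by
  have hle := (stepFiltration hX).le n
  have hWm : Measurable W := hW.mono hle le_rfl
  have hVm : Measurable fun x : ℝ => ‖unitExp (y * x) - z‖ ^ 2 :=
    ((continuous_unitExp.measurable.comp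
      (measurable_id.const_mul y)).sub_const z).norm.pow_const 2
  have hind := indepFun_stepFiltration hX hindep hW hVm
  have hprod := hind.integral_fun_mul_eq_mul_integral
    hWm.aestronglyMeasurable (hVm.comp (hX n)).aestronglyMeasurable
  rw [integral_norm_unitExp_sub_sq hX (hz n), mul_comm] at hprod
  rw [← hprod]
  have hB4 : ∀ ω, ‖W ω * ‖unitExp (y * X n ω) - z‖ ^ 2‖ ≤ B * 2 ^ 2 := by
    intro ω
    rw [norm_mul, norm_pow, norm_norm]
    have h1 := norm_unitExp_sub_le hz1 (y * X n ω)
    have h2 := hB ω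
    have h3 : 0 ≤ B := (norm_nonneg _).trans h2
    gcongr
  refine integral_mono_of_nonneg (Filter.Eventually.of_forall fun ω =>
    mul_nonneg (hW0 ω) (sq_nonneg _)) ?_ (Filter.Eventually.of_forall fun ω => ?_)
  · exact integrable_of_measurable_of_bound (hWm.mul (hVm.comp (hX n))) _ hB4
  · simp only
    refine mul_le_mul_of_nonneg_left ?_ (hW0 ω)
    rw [← sq_abs]
    have h1 := Complex.abs_re_le_norm
      (u * (unitExp (y * randomWalk X n ω) * (unitExp (y * X n ω) - z)))
    rw [norm_mul, norm_mul, norm_unitExp, hu, one_mul, one_mul] at h1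
    gcongr

theorem integrable_expOfMartingale (hX : ∀ j, Measurable (X j)) (hz1 : ‖z‖ ≤ 1) (hu : ‖u‖ = 1)
    (hl : 0 ≤ l) (n : ℕ) : Integrable (expOfMartingale X z y l u n) P :=
  integrable_of_measurable_of_bound
    ((measurable_expOfMartingale_stepFiltration hX n).mono ((stepFiltration hX).le n) le_rfl) _
    (norm_expOfMartingale_le hz1 hu hl n)

theorem measurable_increment_re (hX : ∀ j, Measurable (X j)) (n : ℕ) : Measurable fun ω =>
    (u * (unitExp (y * randomWalk X n ω) * (unitExp (y * X n ω) - z))).re := by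
  refine Complex.measurable_re.comp (Measurable.const_mul (Measurable.mul ?_
    (Measurable.sub_const ?_ _)) u)
  · exact continuous_unitExp.measurable.comp
      (((measurable_randomWalk_stepFiltration hX (le_refl n)).mono
        ((stepFiltration hX).le n) le_rfl).const_mul y)
  · exact continuous_unitExp.measurable.comp ((hX n).const_mul y)

theorem submartingale_expOfMartingale (hX : ∀ j, Measurable (X j)) (hindep : iIndepFun X P)
    (hz : ∀ n, ∫ ω, unitExp (y * X n ω) ∂P = z) (hz1 : ‖z‖ ≤ 1) (hu : ‖u‖ = 1) (hl : 0 ≤ l) :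
    Submartingale (expOfMartingale X z y l u) (stepFiltration hX) P := by
  refine submartingale_of_setIntegral_le_succ
    (fun n => (measurable_expOfMartingale_stepFiltration hX n).stronglyMeasurable)
    (integrable_expOfMartingale hX hz1 hu hl) fun n s hs => ?_
  have hs' : MeasurableSet s := (stepFiltration hX).le n s hs
  set W : Ω → ℝ := s.indicator (expOfMartingale X z y l u n) with hW
  have hWm : Measurable[stepFiltration hX n] W :=
    (measurable_expOfMartingale_stepFiltration hX n).indicator hs
  have hWB : ∀ ω, ‖W ω‖ ≤ Real.exp (l * (2 * n)) := fun ω =>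
    (norm_indicator_le_norm_self _ _).trans (norm_expOfMartingale_le hz1 hu hl n ω)
  have hWm' : Measurable W := hWm.mono ((stepFiltration hX).le n) le_rfl
  have hWi : Integrable W P := integrable_of_measurable_of_bound hWm' _ hWB
  have hzero := integral_mul_increment_re (u := u) hX hindep hz hWm _ hWB
  have hWξ : Integrable (fun ω => W ω *
      (u * (unitExp (y * randomWalk X n ω) * (unitExp (y * X n ω) - z))).re) P := by
    refine integrable_of_measurable_of_bound (hWm'.mul (measurable_increment_re hX n))
      (Real.exp (l * (2 * n)) * 2) fun ω => ?_
    rw [norm_mul]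
    have h1 := hWB ω
    have h2 := (Complex.abs_re_le_norm _).trans
      (norm_increment_le hz1 hu (y * randomWalk X n ω) (y * X n ω))
    rw [Real.norm_eq_abs (Complex.re _)]
    gcongr
  rw [← integral_indicator hs', ← integral_indicator hs']
  calc ∫ ω, W ω ∂P = ∫ ω, (W ω + l * (W ω *
      (u * (unitExp (y * randomWalk X n ω) * (unitExp (y * X n ω) - z))).re)) ∂P := by
        rw [integral_add hWi (hWξ.const_mul l), integral_const_mul, hzero, mul_zero, add_zero]
    _ ≤ _ := by
        refine integral_mono (hWi.add (hWξ.const_mul l))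
          ((integrable_expOfMartingale hX hz1 hu hl (n + 1)).indicator hs') fun ω => ?_
        simp only [hW]
        by_cases hω : ω ∈ s
        · rw [Set.indicator_of_mem hω, Set.indicator_of_mem hω, expOfMartingale_succ]
          have h1 := Real.add_one_le_exp
            (l * (u * (unitExp (y * randomWalk X n ω) * (unitExp (y * X n ω) - z))).re)
          have h2 := mul_le_mul_of_nonneg_left h1
            (expOfMartingale_pos (X := X) (z := z) (y := y) (l := l) (u := u) n ω).le
          linarith
        · rw [Set.indicator_of_notMem hω, Set.indicator_of_notMem hω]
          simp

/-- The exponential moments grow at the rate given by the conditional variance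
`1 - |z|²` of the increments, as long as `l` times their bound `2` is at most `1`. -/
theorem integral_expOfMartingale_le (hX : ∀ j, Measurable (X j)) (hindep : iIndepFun X P)
    (hz : ∀ n, ∫ ω, unitExp (y * X n ω) ∂P = z) (hz1 : ‖z‖ ≤ 1) (hu : ‖u‖ = 1) (hl : 0 ≤ l)
    (hl2 : 2 * l ≤ 1) (n : ℕ) :
    ∫ ω, expOfMartingale X z y l u n ω ∂P ≤ Real.exp (n * (l ^ 2 * (1 - ‖z‖ ^ 2))) := by
  induction n with
  | zero => simp [expOfMartingale, walkMartingale]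
  | succ n ih =>
    set W : Ω → ℝ := expOfMartingale X z y l u n with hW
    set ξ : Ω → ℝ := fun ω =>
      (u * (unitExp (y * randomWalk X n ω) * (unitExp (y * X n ω) - z))).re with hξ
    have hWm : Measurable[stepFiltration hX n] W := measurable_expOfMartingale_stepFiltration hX n
    have hWB : ∀ ω, ‖W ω‖ ≤ Real.exp (l * (2 * n)) := norm_expOfMartingale_le hz1 hu hl n
    have hWi : Integrable W P := integrable_expOfMartingale hX hz1 hu hl n
    have hW0 : ∀ ω, 0 ≤ W ω := fun ω => (expOfMartingale_pos n ω).le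
    have hWm' : Measurable W := hWm.mono ((stepFiltration hX).le n) le_rfl
    have hξm : Measurable ξ := measurable_increment_re hX n
    have hξ2 : ∀ ω, |ξ ω| ≤ 2 := fun ω => (Complex.abs_re_le_norm _).trans
      (norm_increment_le hz1 hu (y * randomWalk X n ω) (y * X n ω))
    have hzero : ∫ ω, W ω * ξ ω ∂P = 0 := integral_mul_increment_re hX hindep hz hWm _ hWB
    have hsq : ∫ ω, W ω * ξ ω ^ 2 ∂P ≤ (1 - ‖z‖ ^ 2) * ∫ ω, W ω ∂P :=
      integral_mul_increment_re_sq_le hX hindep hz hz1 hu hWm hW0 _ hWB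
    have hWξ : Integrable (fun ω => W ω * ξ ω) P := by
      refine integrable_of_measurable_of_bound (hWm'.mul hξm)
        (Real.exp (l * (2 * n)) * 2) fun ω => ?_
      rw [norm_mul, Real.norm_eq_abs (ξ ω)]
      have h1 := hWB ω
      have h2 := hξ2 ω
      gcongr
    have hWξ2 : Integrable (fun ω => W ω * ξ ω ^ 2) P := by
      refine integrable_of_measurable_of_bound (hWm'.mul (hξm.pow_const 2))
        (Real.exp (l * (2 * n)) * 2 ^ 2) fun ω => ?_
      rw [norm_mul, norm_pow, Real.norm_eq_abs (ξ ω)]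
      have h1 := hWB ω
      have h2 := hξ2 ω
      gcongr
    have hz2 : 0 ≤ 1 - ‖z‖ ^ 2 := by nlinarith [norm_nonneg z]
    calc ∫ ω, expOfMartingale X z y l u (n + 1) ω ∂P
        ≤ ∫ ω, (W ω + l * (W ω * ξ ω) + l ^ 2 * (W ω * ξ ω ^ 2)) ∂P := by
          refine integral_mono (integrable_expOfMartingale hX hz1 hu hl (n + 1))
            ((hWi.add (hWξ.const_mul l)).add (hWξ2.const_mul _)) fun ω => ?_
          simp only
          rw [expOfMartingale_succ]
          have habs : |l * ξ ω| ≤ 1 := by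
            rw [abs_mul, abs_of_nonneg hl]
            have := hξ2 ω
            nlinarith [abs_nonneg (ξ ω)]
          have h1 := (abs_le.1 (Real.abs_exp_sub_one_sub_id_le habs)).2
          have h2 : Real.exp (l * ξ ω) ≤ 1 + l * ξ ω + (l * ξ ω) ^ 2 := by linarith
          have h3 := mul_le_mul_of_nonneg_left h2 (hW0 ω)
          refine h3.trans (le_of_eq ?_)
          ring
      _ = ∫ ω, W ω ∂P + l ^ 2 * ∫ ω, W ω * ξ ω ^ 2 ∂P := by
          have h1 := integral_add hWi (hWξ.const_mul l)
          have h2 := integral_add (f := fun ω => W ω + l * (W ω * ξ ω))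
            (hWi.add (hWξ.const_mul l)) (hWξ2.const_mul (l ^ 2))
          rw [h2, h1, integral_const_mul, integral_const_mul, hzero, mul_zero, add_zero]
      _ ≤ (l ^ 2 * (1 - ‖z‖ ^ 2) + 1) * ∫ ω, W ω ∂P := by
          have := mul_le_mul_of_nonneg_left hsq (sq_nonneg l)
          linarith
      _ ≤ Real.exp (l ^ 2 * (1 - ‖z‖ ^ 2)) * Real.exp (n * (l ^ 2 * (1 - ‖z‖ ^ 2))) := by
          gcongr
          · exact integral_nonneg hW0
          · exact Real.add_one_le_exp _
      _ = _ := by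
          rw [← Real.exp_add]
          congr 1
          push_cast
          ring

/-! ### A maximal inequality for weighted sums over the frequencies -/

/-- Four directions suffice to control the modulus of a complex number. -/
theorem exp_half_norm_le_sum_exp_re {l : ℝ} (hl : 0 ≤ l) (w : ℂ) :
    Real.exp (l * ‖w‖ / 2) ≤ ∑ a ∈ Finset.range 4, Real.exp (l * (Complex.I ^ a * w).re) := by
  have hsingle : ∀ a ∈ Finset.range 4, ‖w‖ / 2 ≤ (Complex.I ^ a * w).re →
      Real.exp (l * ‖w‖ / 2) ≤
        ∑ a ∈ Finset.range 4, Real.exp (l * (Complex.I ^ a * w).re) := by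
    intro a ha h
    refine le_trans ?_ (Finset.single_le_sum
      (f := fun a => Real.exp (l * (Complex.I ^ a * w).re)) (fun _ _ => (Real.exp_pos _).le) ha)
    rw [mul_div_assoc]
    gcongr
  have hn := Complex.norm_le_abs_re_add_abs_im w
  have e0 : (Complex.I ^ 0 * w).re = w.re := by simp
  have e1 : (Complex.I ^ 1 * w).re = -w.im := by simp
  have e2 : (Complex.I ^ 2 * w).re = -w.re := by simp
  have e3 : (Complex.I ^ 3 * w).re = w.im := by
    rw [Complex.I_pow_three]
    simp
  have h0 := hsingle 0 (by simp)
  have h1 := hsingle 1 (by simp)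
  have h2 := hsingle 2 (by simp)
  have h3 := hsingle 3 (by simp)
  rw [e0] at h0
  rw [e1] at h1
  rw [e2] at h2
  rw [e3] at h3
  rcases le_total (‖w‖ / 2) |w.re| with h | h
  · rcases le_abs.1 h with h | h
    · exact h0 h
    · exact h2 h
  · rcases le_abs.1 (show ‖w‖ / 2 ≤ |w.im| by linarith) with h | h
    · exact h3 h
    · exact h1 h

/-- By convexity of the exponential the weighted sum of the moduli of the martingales is controlled
by the weighted mean of the processes `expOfMartingale`. That mean is a submartingale, so Doob's
maximal inequality applies to it, uniformly in the number of frequencies. -/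
theorem measure_exists_weightedSum_ge_le (hX : ∀ j, Measurable (X j)) (hindep : iIndepFun X P)
    {ι : Type*} (s : Finset ι) (y : ι → ℝ) (z : ι → ℂ) (p l : ι → ℝ)
    (hz : ∀ i ∈ s, ∀ n, ∫ ω, unitExp (y i * X n ω) ∂P = z i) (hz1 : ∀ i ∈ s, ‖z i‖ ≤ 1)
    (hp : ∀ i ∈ s, 0 ≤ p i) (hp1 : ∑ i ∈ s, p i = 1) (hl : ∀ i ∈ s, 0 ≤ l i)
    (hl2 : ∀ i ∈ s, 2 * l i ≤ 1) {v : ℝ} (hv : ∀ i ∈ s, l i ^ 2 * (1 - ‖z i‖ ^ 2) ≤ v)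
    (N : ℕ) (x : ℝ) :
    P {ω | ∃ n ≤ N, x ≤ ∑ i ∈ s, p i * (l i * ‖walkMartingale X (z i) (y i) n ω‖)} ≤
      ENNReal.ofReal (4 * Real.exp (N * v - x / 2)) := by
  set G : ℕ → Ω → ℝ := ∑ i ∈ s, p i • ∑ a ∈ Finset.range 4,
    expOfMartingale X (z i) (y i) (l i) (Complex.I ^ a) with hG
  have hI : ∀ a : ℕ, ‖Complex.I ^ a‖ = 1 := fun a => by simp
  have hGapp : ∀ n ω, G n ω = ∑ i ∈ s, p i * ∑ a ∈ Finset.range 4,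
      expOfMartingale X (z i) (y i) (l i) (Complex.I ^ a) n ω := by
    intro n ω
    simp [hG, Finset.sum_apply]
  have hsub : Submartingale G (stepFiltration hX) P :=
    submartingale_sum s fun i hi => (submartingale_sum _ fun a _ =>
      submartingale_expOfMartingale hX hindep (hz i hi) (hz1 i hi) (hI a) (hl i hi)).smul_nonneg
        (hp i hi)
  have hG0 : 0 ≤ G := by
    intro n ω
    rw [hGapp]
    exact Finset.sum_nonneg fun i hi => mul_nonneg (hp i hi)
      (Finset.sum_nonneg fun a _ => (expOfMartingale_pos _ _).le)
  have hGint : ∫ ω, G N ω ∂P ≤ 4 * Real.exp (N * v) := by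
    simp_rw [hGapp]
    have hint : ∀ i ∈ s, ∀ a ∈ Finset.range 4,
        Integrable (expOfMartingale X (z i) (y i) (l i) (Complex.I ^ a) N) P := fun i hi a _ =>
      integrable_expOfMartingale hX (hz1 i hi) (hI a) (hl i hi) N
    rw [integral_finsetSum _ fun i hi => (integrable_finsetSum _ (hint i hi)).const_mul _]
    calc _ ≤ ∑ i ∈ s, p i * (4 * Real.exp (N * v)) := by
          refine Finset.sum_le_sum fun i hi => ?_
          rw [integral_const_mul, integral_finsetSum _ (hint i hi)]
          refine mul_le_mul_of_nonneg_left ?_ (hp i hi)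
          calc _ ≤ ∑ _a ∈ Finset.range 4, Real.exp (N * v) := by
                refine Finset.sum_le_sum fun a _ => ?_
                refine (integral_expOfMartingale_le hX hindep (hz i hi) (hz1 i hi) (hI a) (hl i hi)
                  (hl2 i hi) N).trans ?_
                have := hv i hi
                gcongr
            _ = _ := by simp
      _ = _ := by rw [← Finset.sum_mul, hp1, one_mul]
  have hpoint : ∀ n ω, Real.exp ((∑ i ∈ s, p i *
      (l i * ‖walkMartingale X (z i) (y i) n ω‖)) / 2) ≤ G n ω := by
    intro n ω
    have hconv := convexOn_exp.map_sum_le (t := s) (w := p)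
      (p := fun i => l i * ‖walkMartingale X (z i) (y i) n ω‖ / 2) hp hp1 fun _ _ => Set.mem_univ _
    simp only [smul_eq_mul] at hconv
    rw [hGapp, Finset.sum_div]
    simp_rw [mul_div_assoc] at hconv ⊢
    refine hconv.trans (Finset.sum_le_sum fun i hi => ?_)
    refine mul_le_mul_of_nonneg_left ?_ (hp i hi)
    have := exp_half_norm_le_sum_exp_re (hl i hi) (walkMartingale X (z i) (y i) n ω)
    rwa [mul_div_assoc] at this
  set ε : NNReal := ⟨Real.exp (x / 2), (Real.exp_pos _).le⟩ with hε
  have hmax := maximal_ineq hsub hG0 (ε := ε) N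
  set A : Set Ω := {ω | (ε : ℝ) ≤ (Finset.range (N + 1)).sup' Finset.nonempty_range_add_one
    fun k => G k ω} with hA
  have hsubset : {ω | ∃ n ≤ N, x ≤ ∑ i ∈ s, p i *
      (l i * ‖walkMartingale X (z i) (y i) n ω‖)} ⊆ A := by
    rintro ω ⟨n, hn, hx⟩
    have h1 : Real.exp (x / 2) ≤ G n ω := by
      refine le_trans ?_ (hpoint n ω)
      gcongr
    exact h1.trans (Finset.le_sup' (fun k => G k ω) (Finset.mem_range.2 (Nat.lt_succ_of_le hn)))
  have hAint : ∫ ω in A, G N ω ∂P ≤ 4 * Real.exp (N * v) :=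
    (setIntegral_le_integral (hsub.integrable N)
      (Filter.Eventually.of_forall fun ω => hG0 N ω)).trans hGint
  have hεreal : (ε : ENNReal) = ENNReal.ofReal (Real.exp (x / 2)) := by
    rw [ENNReal.ofReal, hε]
    congr 1
    exact (Real.toNNReal_of_nonneg (Real.exp_pos _).le).symm
  have hfinal : ENNReal.ofReal (Real.exp (x / 2)) * P A ≤
      ENNReal.ofReal (4 * Real.exp (N * v)) := by
    rw [← hεreal]
    exact hmax.trans (ENNReal.ofReal_le_ofReal hAint)
  refine (measure_mono hsubset).trans ?_
  rw [Real.exp_sub, ← mul_div_assoc, ENNReal.ofReal_div_of_pos (Real.exp_pos _),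
    ENNReal.le_div_iff_mul_le (Or.inl (by simp [Real.exp_pos])) (Or.inl ENNReal.ofReal_ne_top),
    mul_comm]
  exact hfinal

end Probability

/-! ### Simultaneous almost sure bounds for the exponential sums -/

section ExponentialSums

variable {Ω : Type*} [mΩ : MeasurableSpace Ω] {P : Measure Ω} [IsProbabilityMeasure P]
  {X : ℕ → Ω → ℝ}

/-- The weights `p_h` and the exponents `l_h` are chosen so that `p_h l_h` is proportional to
`1 / (h ‖1 - z_h‖)`, the weight with which the martingale of frequency `h` enters, and so that the
variance bound `l_h² (1 - |z_h|²) ≤ 2 η r` does not depend on `h`. The choice `η = c₀ / 4` makes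
`2 l_h ≤ 1`. -/
theorem measure_exists_weighted_exponentialSum_gt_le (hX : ∀ j, Measurable (X j))
    (hindep : iIndepFun X P) (y : ℕ → ℝ) (z : ℕ → ℂ)
    (hz : ∀ h n, ∫ ω, unitExp (y h * X n ω) ∂P = z h) (hz1 : ∀ h, ‖z h‖ ≤ 1)
    {c₀ L : ℝ} (hc₀ : 0 < c₀) (hL : 1 ≤ L) {N H : ℕ} (hN : 0 < N)
    (hb : ∀ h ∈ Finset.Icc 1 H, c₀ * (L / N) ≤ ‖1 - z h‖) :
    P {ω | ∃ n ≤ N, ((c₀ + 4) / √(c₀ / 4) + 2 / √c₀) * (N * √(L / N)) *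
        (∑ h ∈ Finset.Icc 1 H, 1 / (h : ℝ) * (1 / √‖1 - z h‖)) <
        ∑ h ∈ Finset.Icc 1 H, 1 / (h : ℝ) *
          ‖∑ k ∈ Finset.Icc 1 n, unitExp (y h * randomWalk X k ω)‖} ≤
      ENNReal.ofReal (4 * Real.exp (-2 * L)) := by
  have hN' : (0 : ℝ) < N := by exact_mod_cast hN
  set r := L / N with hr
  have hr0 : 0 < r := by positivity
  have hNr : N * r = L := by
    rw [hr]
    field_simp
  rcases Nat.eq_zero_or_pos H with rfl | hH
  · simp
  set b : ℕ → ℝ := fun h => ‖1 - z h‖ with hbdef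
  have hb0 : ∀ h ∈ Finset.Icc 1 H, 0 < b h := fun h hh =>
    lt_of_lt_of_le (by positivity) (hb h hh)
  have hh0 : ∀ h ∈ Finset.Icc 1 H, (0 : ℝ) < h := fun h hh => by
    exact_mod_cast (Finset.mem_Icc.1 hh).1
  set W := ∑ h ∈ Finset.Icc 1 H, 1 / (h : ℝ) * (1 / √(b h)) with hW
  have hW0 : 0 < W := by
    refine Finset.sum_pos (fun h hh => ?_) ⟨1, Finset.mem_Icc.2 ⟨le_rfl, hH⟩⟩
    have h1 := hb0 h hh
    have h2 := hh0 h hh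
    positivity
  set η := c₀ / 4 with hη
  have hη0 : 0 < η := by positivity
  have hηr : 0 < √(η * r) := by positivity
  set p : ℕ → ℝ := fun h => 1 / (h : ℝ) * (1 / √(b h)) / W with hp
  set l : ℕ → ℝ := fun h => √(η * r) / √(b h) with hl
  have hlsq : ∀ h ∈ Finset.Icc 1 H, l h ^ 2 = η * r / b h := fun h hh => by
    simp only [hl]
    rw [div_pow, Real.sq_sqrt (by positivity), Real.sq_sqrt (hb0 h hh).le]
  have hmain := measure_exists_weightedSum_ge_le (P := P) hX hindep (Finset.Icc 1 H) y z p l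
    (fun h _ => hz h) (fun h _ => hz1 h) (fun h _ => by positivity)
    (by rw [← Finset.sum_div, div_self hW0.ne']) (fun h _ => by positivity)
    (fun h hh => by
      have h1 : l h ^ 2 ≤ (1 / 2) ^ 2 := by
        rw [hlsq h hh, div_le_iff₀ (hb0 h hh)]
        have := hb h hh
        simp only [hbdef, hη]
        linarith
      have h2 := abs_le_of_sq_le_sq h1 (by norm_num)
      linarith [le_abs_self (l h)])
    (v := 2 * η * r)
    (fun h hh => by
      rw [hlsq h hh, div_mul_eq_mul_div, div_le_iff₀ (hb0 h hh)]
      have h1 : 1 - ‖z h‖ ≤ b h := by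
        have := norm_sub_norm_le (1 : ℂ) (z h)
        rwa [norm_one] at this
      have h2 : 1 - ‖z h‖ ^ 2 ≤ 2 * b h := by nlinarith [hz1 h, norm_nonneg (z h)]
      calc η * r * (1 - ‖z h‖ ^ 2) ≤ η * r * (2 * b h) := by gcongr
        _ = _ := by ring) N ((4 * η + 4) * L)
  have hexp : N * (2 * η * r) - (4 * η + 4) * L / 2 = -2 * L := by
    linear_combination (2 * η) * hNr
  rw [hexp] at hmain
  refine (measure_mono ?_).trans hmain
  rintro ω ⟨n, hn, hω⟩
  refine ⟨n, hn, ?_⟩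
  by_contra! hcon
  refine absurd hω (not_lt.2 ?_)
  set M : ℕ → ℝ := fun h => ‖walkMartingale X (z h) (y h) n ω‖ with hM
  have hpl : ∑ h ∈ Finset.Icc 1 H, p h * (l h * M h) =
      √(η * r) / W * ∑ h ∈ Finset.Icc 1 H, 1 / (h : ℝ) * (M h / b h) := by
    rw [Finset.mul_sum]
    refine Finset.sum_congr rfl fun h hh => ?_
    have h1 := hb0 h hh
    have h2 : √(b h) ≠ 0 := by positivity
    simp only [hp, hl]
    calc _ = √(η * r) / W * (1 / (h : ℝ) * (M h / (√(b h) * √(b h)))) := by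
          field_simp
      _ = _ := by rw [Real.mul_self_sqrt h1.le]
  rw [hpl] at hcon
  have hA : ∑ h ∈ Finset.Icc 1 H, 1 / (h : ℝ) * (M h / b h) ≤
      (c₀ + 4) / √η * (N * √r) * W := by
    have h1 : √(η * r) / W * ∑ h ∈ Finset.Icc 1 H, 1 / (h : ℝ) * (M h / b h) * 1 ≤
        √(η * r) / W * ((c₀ + 4) / √η * (N * √r) * W) := by
      simp only [mul_one]
      refine hcon.le.trans (le_of_eq ?_)
      have h2 : √η ≠ 0 := by positivity
      have h3 : √r * √r = r := Real.mul_self_sqrt hr0.le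
      rw [Real.sqrt_mul hη0.le, ← hNr]
      have h4 : 4 * η = c₀ := by
        rw [hη]
        ring
      calc (4 * η + 4) * (N * r) = (c₀ + 4) * (N * (√r * √r)) := by rw [h4, h3]
        _ = _ := by field_simp
    simp only [mul_one] at h1
    exact le_of_mul_le_mul_left h1 (by positivity)
  have hB : ∑ h ∈ Finset.Icc 1 H, 1 / (h : ℝ) * (2 / b h) ≤ 2 / √c₀ * (N * √r) * W := by
    rw [hW, Finset.mul_sum]
    refine Finset.sum_le_sum fun h hh => ?_
    have h1 := hb0 h hh
    have h2 := hh0 h hh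
    have h3 : √c₀ * √r ≤ √(b h) := by
      rw [← Real.sqrt_mul hc₀.le]
      exact Real.sqrt_le_sqrt (hb h hh)
    have h4 : √(b h) * √(b h) = b h := Real.mul_self_sqrt h1.le
    have h5 : √r * √r = r := Real.mul_self_sqrt hr0.le
    have h6 : 1 ≤ N * √r * √r := by
      rw [mul_assoc, h5, hNr]
      exact hL
    have h7 : 1 / √(b h) ≤ 1 / √c₀ * (N * √r) := by
      have hs : 0 < √c₀ := by positivity
      have hsr : 0 < √r := by positivity
      calc 1 / √(b h) ≤ 1 / (√c₀ * √r) := by gcongr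
        _ ≤ N * √r * √r / (√c₀ * √r) := by gcongr
        _ = _ := by field_simp
    calc 1 / (h : ℝ) * (2 / b h) = 2 * (1 / √(b h)) * (1 / (h : ℝ) * (1 / √(b h))) := by
          have h8 : √(b h) ≠ 0 := by positivity
          calc _ = 1 / (h : ℝ) * (2 / (√(b h) * √(b h))) := by rw [h4]
            _ = _ := by field_simp
      _ ≤ 2 * (1 / √c₀ * (N * √r)) * (1 / (h : ℝ) * (1 / √(b h))) := by gcongr
      _ = _ := by ring
  calc _ ≤ ∑ h ∈ Finset.Icc 1 H, (1 / (h : ℝ) * (M h / b h) + 1 / (h : ℝ) * (2 / b h)) := by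
        refine Finset.sum_le_sum fun h hh => ?_
        rw [← mul_add, ← add_div]
        refine mul_le_mul_of_nonneg_left ?_ (by positivity)
        rw [le_div_iff₀ (hb0 h hh), mul_comm]
        exact norm_sum_unitExp_randomWalk_le X (hz1 h) (y h) n ω
    _ ≤ (c₀ + 4) / √η * (N * √r) * W + 2 / √c₀ * (N * √r) * W := by
        rw [Finset.sum_add_distrib]
        exact add_le_add hA hB
    _ = _ := by ring

theorem one_le_log_natCast {m : ℕ} (hm : 3 ≤ m) : 1 ≤ Real.log m := by
  have h3 : (3 : ℝ) ≤ m := by exact_mod_cast hm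
  rw [Real.le_log_iff_exp_le (by linarith)]
  linarith [Real.exp_one_lt_d9]

/-- The normalized iterated logarithm `log m / 2 ^ m` at the dyadic scale `m`. -/
noncomputable def dyadicRate (m : ℕ) : ℝ := Real.log m / ((2 ^ m : ℕ) : ℝ)

/-- The number of frequencies used at the dyadic scale `m`, the largest for which the frequencies
satisfy `h ^ (-E) ≥ log m / 2 ^ m`. -/
noncomputable def frequencyCutoff (E : ℝ) (m : ℕ) : ℕ := ⌊dyadicRate m ^ (-(1 / E))⌋₊

theorem dyadicRate_pos {m : ℕ} (hm : 3 ≤ m) : 0 < dyadicRate m := by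
  have := one_le_log_natCast hm
  unfold dyadicRate
  positivity

theorem dyadicRate_le_one (m : ℕ) : dyadicRate m ≤ 1 := by
  unfold dyadicRate
  refine div_le_one_of_le₀ ?_ (by positivity)
  have h1 := Real.log_le_self (Nat.cast_nonneg (α := ℝ) m)
  have h2 : (m : ℝ) ≤ ((2 ^ m : ℕ) : ℝ) := by exact_mod_cast Nat.lt_two_pow_self.le
  linarith

theorem dyadicRate_le_rpow_neg {E : ℝ} (hE : 0 < E) {m h : ℕ} (hm : 3 ≤ m)
    (hh : h ∈ Finset.Icc 1 (frequencyCutoff E m)) : dyadicRate m ≤ (h : ℝ) ^ (-E) := by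
  have hr := dyadicRate_pos hm
  have h0 : (0 : ℝ) < h := by exact_mod_cast (Finset.mem_Icc.1 hh).1
  have h1 : (h : ℝ) ≤ dyadicRate m ^ (-(1 / E)) :=
    (Nat.le_floor_iff (by positivity)).1 (Finset.mem_Icc.1 hh).2
  have h2 := Real.rpow_le_rpow_of_nonpos h0 h1 (by linarith : -E ≤ 0)
  rw [← Real.rpow_mul hr.le] at h2
  have h3 : -(1 / E) * -E = 1 := by field_simp
  rwa [h3, Real.rpow_one] at h2

/-- Almost surely the weighted exponential sums obey a bound of law-of-the-iterated-logarithm type,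
uniformly over the frequencies up to the cutoff. -/
theorem exists_ae_eventually_weighted_exponentialSum_le (hX : ∀ j, Measurable (X j))
    (hindep : iIndepFun X P) (y : ℕ → ℝ) (z : ℕ → ℂ)
    (hz : ∀ h n, ∫ ω, unitExp (y h * X n ω) ∂P = z h) (hz1 : ∀ h, ‖z h‖ ≤ 1)
    {c₀ E : ℝ} (hc₀ : 0 < c₀) (hE : 0 < E)
    (hb : ∀ h : ℕ, 0 < h → c₀ * (h : ℝ) ^ (-E) ≤ ‖1 - z h‖) :
    ∃ K : ℝ, 0 < K ∧ ∀ᵐ ω ∂P, ∀ᶠ m : ℕ in atTop, ∀ n ≤ 2 ^ m,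
      ∑ h ∈ Finset.Icc 1 (frequencyCutoff E m), 1 / (h : ℝ) *
          ‖∑ k ∈ Finset.Icc 1 n, unitExp (y h * randomWalk X k ω)‖ ≤
        K * (((2 ^ m : ℕ) : ℝ) * √(dyadicRate m)) *
          ∑ h ∈ Finset.Icc 1 (frequencyCutoff E m), 1 / (h : ℝ) * (1 / √‖1 - z h‖) := by
  refine ⟨(c₀ + 4) / √(c₀ / 4) + 2 / √c₀, by positivity, ?_⟩
  set K := (c₀ + 4) / √(c₀ / 4) + 2 / √c₀ with hK
  set A : ℕ → Set Ω := fun m => {ω | 3 ≤ m ∧ ∃ n ≤ 2 ^ m,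
    K * (((2 ^ m : ℕ) : ℝ) * √(dyadicRate m)) *
      (∑ h ∈ Finset.Icc 1 (frequencyCutoff E m), 1 / (h : ℝ) * (1 / √‖1 - z h‖)) <
    ∑ h ∈ Finset.Icc 1 (frequencyCutoff E m), 1 / (h : ℝ) *
      ‖∑ k ∈ Finset.Icc 1 n, unitExp (y h * randomWalk X k ω)‖} with hA
  have hPA : ∀ m, P (A m) ≤ ENNReal.ofReal (4 * ((m : ℝ) ^ 2)⁻¹) := by
    intro m
    by_cases hm : 3 ≤ m
    · have hm' : (0 : ℝ) < m := by
        have : 0 < m := by omega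
        exact_mod_cast this
      have h1 := measure_exists_weighted_exponentialSum_gt_le (P := P) hX hindep y z hz hz1 hc₀
        (one_le_log_natCast hm) (N := 2 ^ m) (H := frequencyCutoff E m) (by positivity)
        (fun h hh => (mul_le_mul_of_nonneg_left (dyadicRate_le_rpow_neg hE hm hh) hc₀.le).trans
          (hb h (Finset.mem_Icc.1 hh).1))
      have h2 : Real.exp (-2 * Real.log m) = ((m : ℝ) ^ 2)⁻¹ := by
        rw [neg_mul, Real.exp_neg, two_mul, Real.exp_add, Real.exp_log hm', sq]
      rw [h2] at h1
      refine (measure_mono ?_).trans h1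
      rintro ω ⟨-, h⟩
      exact h
    · have : A m = ∅ := by
        ext ω
        simp [hA, hm]
      rw [this, measure_empty]
      exact zero_le
  have hsum : Summable fun m : ℕ => 4 * ((m : ℝ) ^ 2)⁻¹ :=
    (Real.summable_nat_pow_inv.2 (by norm_num)).mul_left 4
  have hne : ∑' m, P (A m) ≠ ⊤ :=
    ne_top_of_le_ne_top hsum.tsum_ofReal_ne_top (ENNReal.tsum_le_tsum hPA)
  filter_upwards [ae_eventually_notMem hne] with ω hω
  filter_upwards [hω, eventually_ge_atTop 3] with m hm hm3 n hn
  by_contra! hcon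
  exact hm ⟨hm3, n, hn, hcon⟩

end ExponentialSums

/-! ### From exponential sums to the discrepancy -/

theorem discrepancy_nonneg (x : ℕ → ℝ) (N : ℕ) : 0 ≤ discrepancy x N := by
  refine Real.sSup_nonneg ?_
  rintro r ⟨a, b, -, -, -, rfl⟩
  exact abs_nonneg _

/-- The dyadic scale `m` of `n`, so that `2 ^ (m - 1) ≤ n < 2 ^ m`. -/
def dyadicIndex (n : ℕ) : ℕ := Nat.log 2 n + 1

theorem lt_two_pow_dyadicIndex (n : ℕ) : n < 2 ^ dyadicIndex n :=
  Nat.lt_pow_succ_log_self (by norm_num) n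

theorem two_pow_dyadicIndex_le {n : ℕ} (hn : 0 < n) : 2 ^ dyadicIndex n ≤ 2 * n := by
  rw [dyadicIndex, pow_succ, mul_comm]
  exact Nat.mul_le_mul_left 2 (Nat.pow_log_le_self 2 hn.ne')

theorem three_le_dyadicIndex {n : ℕ} (hn : 4 ≤ n) : 3 ≤ dyadicIndex n := by
  have : 2 ≤ Nat.log 2 n := Nat.le_log_of_pow_le (by norm_num) (by simpa using hn)
  rw [dyadicIndex]
  omega

theorem tendsto_dyadicIndex : Tendsto dyadicIndex atTop atTop := by
  refine tendsto_atTop.2 fun b => ?_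
  filter_upwards [eventually_ge_atTop (2 ^ b)] with n hn
  have : b ≤ Nat.log 2 n := Nat.le_log_of_pow_le (by norm_num) hn
  rw [dyadicIndex]
  omega

theorem dyadicRate_dyadicIndex_le {n : ℕ} (hn : 3 ≤ Real.log n) :
    dyadicRate (dyadicIndex n) ≤ 2 * (Real.log (Real.log n) / n) := by
  have hn0 : (0 : ℝ) < n := by
    by_contra! h
    have h1 : (n : ℝ) = 0 := le_antisymm h (Nat.cast_nonneg n)
    rw [h1, Real.log_zero] at hn
    linarith
  have hn0' : n ≠ 0 := by
    rintro rfl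
    simp at hn0
  have h1 : ((Nat.log 2 n : ℕ) : ℝ) * Real.log 2 ≤ Real.log n := by
    rw [← Real.log_pow]
    refine Real.log_le_log (by positivity) ?_
    exact_mod_cast Nat.pow_log_le_self 2 hn0'
  have h2 : ((Nat.log 2 n : ℕ) : ℝ) ≤ 2 * Real.log n := by
    nlinarith [Real.log_two_gt_d9, Nat.cast_nonneg (α := ℝ) (Nat.log 2 n)]
  have h3 : ((dyadicIndex n : ℕ) : ℝ) ≤ Real.log n ^ 2 := by
    rw [dyadicIndex]
    push_cast
    nlinarith
  have h4 : Real.log (dyadicIndex n) ≤ 2 * Real.log (Real.log n) := by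
    have h5 := Real.log_le_log (by rw [dyadicIndex]; positivity) h3
    rwa [Real.log_pow] at h5
  have h6 : (n : ℝ) ≤ ((2 ^ dyadicIndex n : ℕ) : ℝ) := by
    exact_mod_cast (lt_two_pow_dyadicIndex n).le
  have h7 : 0 ≤ Real.log (dyadicIndex n) := Real.log_natCast_nonneg _
  unfold dyadicRate
  calc _ ≤ Real.log (dyadicIndex n) / n := by gcongr
    _ ≤ 2 * Real.log (Real.log n) / n := by gcongr
    _ = _ := by ring

theorem one_div_frequencyCutoff_le {E : ℝ} (hE : 0 < E) {m : ℕ} (hm : 3 ≤ m) :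
    0 < frequencyCutoff E m ∧
      1 / (frequencyCutoff E m : ℝ) ≤ 2 * dyadicRate m ^ (1 / E) := by
  have hr := dyadicRate_pos hm
  have h1 : 1 ≤ dyadicRate m ^ (-(1 / E)) :=
    Real.one_le_rpow_of_pos_of_le_one_of_nonpos hr (dyadicRate_le_one m)
      (by
        have : 0 < 1 / E := by positivity
        linarith)
  have hpos : 0 < frequencyCutoff E m := Nat.floor_pos.2 h1
  have hpos' : (1 : ℝ) ≤ frequencyCutoff E m := by exact_mod_cast hpos
  refine ⟨hpos, ?_⟩
  have h2 : dyadicRate m ^ (-(1 / E)) < frequencyCutoff E m + 1 := Nat.lt_floor_add_one _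
  rw [Real.rpow_neg hr.le, inv_lt_iff_one_lt_mul₀ (by positivity)] at h2
  rw [div_le_iff₀ (by linarith)]
  have h3 : 0 < dyadicRate m ^ (1 / E) := by positivity
  nlinarith

/-- The discrepancy at time `n`, in terms of the weighted sum over the frequencies up to the cutoff
at the dyadic scale of `n`. -/
theorem exists_ae_eventually_discrepancy_le {Ω : Type*} [MeasurableSpace Ω] {P : Measure Ω}
    [IsProbabilityMeasure P] {X : ℕ → Ω → ℝ} (hX : ∀ j, Measurable (X j))
    (hindep : iIndepFun X P) (α : ℝ) (z : ℕ → ℂ)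
    (hz : ∀ h n : ℕ, ∫ ω, unitExp (h * α * X n ω) ∂P = z h) (hz1 : ∀ h, ‖z h‖ ≤ 1)
    {c₀ E : ℝ} (hc₀ : 0 < c₀) (hE : 0 < E)
    (hb : ∀ h : ℕ, 0 < h → c₀ * (h : ℝ) ^ (-E) ≤ ‖1 - z h‖) :
    ∃ K : ℝ, 0 < K ∧ ∀ᵐ ω ∂P, ∀ᶠ n : ℕ in atTop,
      discrepancy (fun k => Int.fract (randomWalk X k ω * α)) n ≤
        K * (dyadicRate (dyadicIndex n) ^ (1 / E) + √(dyadicRate (dyadicIndex n)) *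
          ∑ h ∈ Finset.Icc 1 (frequencyCutoff E (dyadicIndex n)),
            1 / (h : ℝ) * (1 / √‖1 - z h‖)) := by
  obtain ⟨K, hK, hae⟩ := exists_ae_eventually_weighted_exponentialSum_le (P := P) hX hindep
    (fun h => h * α) z hz hz1 hc₀ hE hb
  have hpi := Real.pi_pos
  refine ⟨32 * Real.pi + 4 / Real.pi * (2 * K), by positivity, ?_⟩
  filter_upwards [hae] with ω hω
  filter_upwards [tendsto_dyadicIndex.eventually hω, eventually_ge_atTop 4] with n hn hn4
  have hn0 : 0 < n := by omega
  have hn0' : (0 : ℝ) < n := by exact_mod_cast hn0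
  obtain ⟨hHpos, hH⟩ := one_div_frequencyCutoff_le hE (three_le_dyadicIndex hn4)
  have hr := dyadicRate_pos (three_le_dyadicIndex hn4)
  have h2m : ((2 ^ dyadicIndex n : ℕ) : ℝ) ≤ 2 * n := by
    exact_mod_cast two_pow_dyadicIndex_le hn0
  have hsum := hn n (lt_two_pow_dyadicIndex n).le
  set m := dyadicIndex n with hm
  set H := frequencyCutoff E m with hHdef
  set W := ∑ h ∈ Finset.Icc 1 H, 1 / (h : ℝ) * (1 / √‖1 - z h‖) with hW
  have hW0 : 0 ≤ W := Finset.sum_nonneg fun h _ => by positivity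
  have hET := discrepancy_le_erdosTuran (fun k => Int.fract (randomWalk X k ω * α)) hn0 hHpos
  refine hET.trans ?_
  have hchar : ∀ h k : ℕ, unitExp (h * Int.fract (randomWalk X k ω * α)) =
      unitExp (h * α * randomWalk X k ω) := by
    intro h k
    rw [unitExp_mul_fract]
    congr 1
    ring
  simp_rw [hchar]
  have h1 : ∑ h ∈ Finset.Icc 1 H, 1 / (h : ℝ) *
      (‖∑ k ∈ Finset.Icc 1 n, unitExp (h * α * randomWalk X k ω)‖ / n) ≤
      2 * K * (√(dyadicRate m) * W) := by
    simp_rw [← mul_div_assoc]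
    rw [← Finset.sum_div, div_le_iff₀ hn0']
    refine hsum.trans ?_
    calc _ ≤ K * (2 * n * √(dyadicRate m)) * W := by gcongr
      _ = _ := by ring
  have h2 : 16 * Real.pi / H ≤ 32 * Real.pi * dyadicRate m ^ (1 / E) := by
    calc 16 * Real.pi / (H : ℝ) = 16 * Real.pi * (1 / (H : ℝ)) := by ring
      _ ≤ 16 * Real.pi * (2 * dyadicRate m ^ (1 / E)) := by gcongr
      _ = _ := by ring
  have h3 : 0 ≤ dyadicRate m ^ (1 / E) := by positivity
  have h4 : 0 ≤ √(dyadicRate m) * W := by positivity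
  calc _ ≤ 32 * Real.pi * dyadicRate m ^ (1 / E)
        + 4 / Real.pi * (2 * K * (√(dyadicRate m) * W)) := by gcongr
    _ ≤ 32 * Real.pi * dyadicRate m ^ (1 / E)
        + 4 / Real.pi * (2 * K * (√(dyadicRate m) * W))
        + (32 * Real.pi * (√(dyadicRate m) * W)
          + 4 / Real.pi * (2 * K) * dyadicRate m ^ (1 / E)) :=
        le_add_of_nonneg_right (by positivity)
    _ = _ := by ring

/-! ### The rates -/

theorem log_frequencyCutoff_two_le {n : ℕ} (hn : 4 ≤ n) :
    Real.log (frequencyCutoff 2 (dyadicIndex n)) ≤ Real.log n := by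
  have hm := three_le_dyadicIndex hn
  have hr := dyadicRate_pos hm
  have hn0 : (4 : ℝ) ≤ n := by exact_mod_cast hn
  obtain ⟨hpos, -⟩ := one_div_frequencyCutoff_le (E := 2) (by norm_num) hm
  refine Real.log_le_log (by exact_mod_cast hpos) ?_
  have h1 : (frequencyCutoff 2 (dyadicIndex n) : ℝ) ≤ dyadicRate (dyadicIndex n) ^ (-(1 / 2) : ℝ) :=
    Nat.floor_le (by positivity)
  have h2m : ((2 ^ dyadicIndex n : ℕ) : ℝ) ≤ 2 * n := by
    exact_mod_cast two_pow_dyadicIndex_le (by omega)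
  have h2 : 1 / (2 * (n : ℝ)) ≤ dyadicRate (dyadicIndex n) := by
    have := one_le_log_natCast hm
    unfold dyadicRate
    gcongr
  have h3 : 1 / (n : ℝ) ^ 2 ≤ dyadicRate (dyadicIndex n) := by
    refine le_trans ?_ h2
    have : 2 * (n : ℝ) ≤ n ^ 2 := by nlinarith
    gcongr
  refine h1.trans ?_
  calc dyadicRate (dyadicIndex n) ^ (-(1 / 2) : ℝ) ≤ (1 / (n : ℝ) ^ 2) ^ (-(1 / 2) : ℝ) :=
        Real.rpow_le_rpow_of_nonpos (by positivity) h3 (by norm_num)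
    _ = n := by
        rw [one_div, ← Real.rpow_natCast, ← Real.rpow_neg (by positivity),
          ← Real.rpow_mul (by positivity)]
        norm_num

/-- Logarithmic frequency sums give the rate `√(log log n / n)`, up to powers of `log n`. -/
theorem isBigO_of_eventually_le_log {D : ℕ → ℝ} {W : ℕ → ℝ} {K K' : ℝ} {s : ℕ}
    (hD0 : ∀ n, 0 ≤ D n) (hK : 0 < K) (hK' : 0 < K')
    (hW : ∀ H : ℕ, W H ≤ K' * (1 + Real.log H) ^ s)
    (hD : ∀ᶠ n : ℕ in atTop, D n ≤ K * (dyadicRate (dyadicIndex n) ^ (1 / 2 : ℝ) +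
      √(dyadicRate (dyadicIndex n)) * W (frequencyCutoff 2 (dyadicIndex n)))) :
    D =O[atTop] fun n : ℕ => √(Real.log (Real.log n) / n) * Real.log n ^ s := by
  refine IsBigO.of_bound (K * (√2 * (1 + K' * 2 ^ s))) ?_
  have hlog : ∀ᶠ n : ℕ in atTop, 3 ≤ Real.log n :=
    (Real.tendsto_log_atTop.comp tendsto_natCast_atTop_atTop).eventually_ge_atTop 3
  filter_upwards [hD, hlog, eventually_ge_atTop 4] with n hn hn3 hn4
  have hr := dyadicRate_pos (three_le_dyadicIndex hn4)
  have hrate := dyadicRate_dyadicIndex_le hn3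
  have hLL : 0 ≤ Real.log (Real.log n) := Real.log_nonneg (by linarith)
  set r := dyadicRate (dyadicIndex n) with hrdef
  set q := Real.log (Real.log n) / n with hq
  have hq0 : 0 ≤ q := by positivity
  rw [Real.norm_of_nonneg (hD0 n), Real.norm_of_nonneg (by positivity)]
  rw [← Real.sqrt_eq_rpow] at hn
  have h1 : √r ≤ √2 * √q := by
    rw [← Real.sqrt_mul (by norm_num)]
    exact Real.sqrt_le_sqrt hrate
  have h2 : W (frequencyCutoff 2 (dyadicIndex n)) ≤ K' * 2 ^ s * Real.log n ^ s := by
    refine (hW _).trans ?_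
    rw [mul_assoc, ← mul_pow]
    have h3 := log_frequencyCutoff_two_le hn4
    have h4 : 0 ≤ Real.log (frequencyCutoff 2 (dyadicIndex n)) := Real.log_natCast_nonneg _
    gcongr
    linarith
  have h5 : 1 ≤ Real.log n ^ s := one_le_pow₀ (by linarith)
  calc D n ≤ K * (√r + √r * W (frequencyCutoff 2 (dyadicIndex n))) := hn
    _ ≤ K * (√r * Real.log n ^ s + √r * (K' * 2 ^ s * Real.log n ^ s)) := by
        gcongr
        exact le_mul_of_one_le_right (by positivity) h5
    _ = K * (√r * ((1 + K' * 2 ^ s) * Real.log n ^ s)) := by ring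
    _ ≤ K * (√2 * √q * ((1 + K' * 2 ^ s) * Real.log n ^ s)) := by gcongr
    _ = _ := by ring

/-- Frequency sums of order `H ^ (E / 2 - 1)` give the rate `(log log n / n) ^ (1 / E)`. -/
theorem isBigO_of_eventually_le_rpow {D : ℕ → ℝ} {W : ℕ → ℝ} {K K' E : ℝ} (hE : 2 < E)
    (hD0 : ∀ n, 0 ≤ D n) (hK : 0 < K) (hK' : 0 < K')
    (hW : ∀ H : ℕ, W H ≤ K' * (H : ℝ) ^ (E / 2 - 1))
    (hD : ∀ᶠ n : ℕ in atTop, D n ≤ K * (dyadicRate (dyadicIndex n) ^ (1 / E) +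
      √(dyadicRate (dyadicIndex n)) * W (frequencyCutoff E (dyadicIndex n)))) :
    D =O[atTop] fun n : ℕ => (Real.log (Real.log n) / n) ^ (1 / E) := by
  have hE0 : 0 < E := by linarith
  refine IsBigO.of_bound (K * (1 + K') * 2 ^ (1 / E)) ?_
  have hlog : ∀ᶠ n : ℕ in atTop, 3 ≤ Real.log n :=
    (Real.tendsto_log_atTop.comp tendsto_natCast_atTop_atTop).eventually_ge_atTop 3
  filter_upwards [hD, hlog, eventually_ge_atTop 4] with n hn hn3 hn4
  have hr := dyadicRate_pos (three_le_dyadicIndex hn4)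
  have hrate := dyadicRate_dyadicIndex_le hn3
  have hLL : 0 ≤ Real.log (Real.log n) := Real.log_nonneg (by linarith)
  set r := dyadicRate (dyadicIndex n) with hrdef
  set q := Real.log (Real.log n) / n with hq
  have hq0 : 0 ≤ q := by positivity
  rw [Real.norm_of_nonneg (hD0 n), Real.norm_of_nonneg (by positivity)]
  have h1 : √r * W (frequencyCutoff E (dyadicIndex n)) ≤ K' * r ^ (1 / E) := by
    have h2 : (frequencyCutoff E (dyadicIndex n) : ℝ) ≤ r ^ (-(1 / E)) :=
      Nat.floor_le (by positivity)
    calc √r * W (frequencyCutoff E (dyadicIndex n))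
        ≤ √r * (K' * (r ^ (-(1 / E))) ^ (E / 2 - 1)) := by
          gcongr
          refine (hW _).trans ?_
          gcongr
          linarith
      _ = K' * (r ^ (1 / 2 : ℝ) * (r ^ (-(1 / E))) ^ (E / 2 - 1)) := by
          rw [Real.sqrt_eq_rpow]
          ring
      _ = K' * r ^ (1 / E) := by
          rw [← Real.rpow_mul hr.le, ← Real.rpow_add hr]
          congr 2
          field_simp
          ring
  calc D n ≤ K * (r ^ (1 / E) + √r * W (frequencyCutoff E (dyadicIndex n))) := hn
    _ ≤ K * (r ^ (1 / E) + K' * r ^ (1 / E)) := by gcongr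
    _ = K * (1 + K') * r ^ (1 / E) := by ring
    _ ≤ K * (1 + K') * (2 * q) ^ (1 / E) := by gcongr
    _ = _ := by
        rw [Real.mul_rpow (by norm_num) hq0]
        ring

/-- The mean of `e(y X_n)` is the value of the characteristic function at `2πy`. -/
theorem integral_unitExp_mul_eq_charFun {Ω : Type*} [MeasurableSpace Ω] {P : Measure Ω}
    {X : Ω → ℝ} (hX : Measurable X) (y : ℝ) :
    ∫ ω, unitExp (y * X ω) ∂P = charFun (P.map X) (2 * Real.pi * y) := by
  rw [charFun_apply_real, integral_map hX.aemeasurable (by fun_prop)]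
  refine integral_congr_ae (Filter.Eventually.of_forall fun ω => ?_)
  simp only [unitExp]
  congr 1
  push_cast
  ring

/-- Both hypotheses on the characteristic function imply `‖1 - φ(2πx)‖ ≥ c ‖dx‖ ^ β`, and this is
all that is used about it. -/
theorem ae_discrepancy_isBigO {Ω : Type*} [MeasurableSpace Ω] (P : Measure Ω)
    [IsProbabilityMeasure P] (X : ℕ → Ω → ℝ) (hindep : iIndepFun X P)
    (hident : ∀ j, IdentDistrib (X j) (X 0) P P) (α : ℝ) (γ C : ℝ) (hγ : 1 ≤ γ) (hC : 0 < C)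
    (hdio : ∀ q : ℕ, 0 < q → C * (q : ℝ) ^ (-γ) ≤ distInt (q * α)) (β c : ℝ) (d : ℕ)
    (hβ : 0 < β) (hβ2 : β ≤ 2) (hc : 0 < c) (hd : 0 < d)
    (hφ : ∀ x : ℝ, c * distInt (d * x) ^ β ≤ ‖1 - charFun (P.map (X 0)) (2 * Real.pi * x)‖) :
    (γ ≤ 2 / β → ∀ᵐ ω ∂P,
      (fun N : ℕ => discrepancy (fun k => Int.fract (randomWalk X k ω * α)) N) =O[atTop]
        (fun N : ℕ => √(Real.log (Real.log N) / N) * Real.log N ^ (if β < 2 then 1 else 2 : ℕ))) ∧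
    (2 / β < γ → ∀ᵐ ω ∂P,
      (fun N : ℕ => discrepancy (fun k => Int.fract (randomWalk X k ω * α)) N) =O[atTop]
        (fun N : ℕ => (Real.log (Real.log N) / N) ^ (1 / (β * γ)))) := by
  have hd' : (0 : ℝ) < d := by exact_mod_cast hd
  -- Measurable versions of the steps; this changes the walk only on a null set.
  set Y : ℕ → Ω → ℝ := fun j => (hident j).aemeasurable_fst.mk (X j) with hYdef
  have hYm : ∀ j, Measurable (Y j) := fun j => (hident j).aemeasurable_fst.measurable_mk
  have hXY : ∀ j, X j =ᵐ[P] Y j := fun j => (hident j).aemeasurable_fst.ae_eq_mk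
  have hYindep : iIndepFun Y P := hindep.congr hXY
  have hwalk : ∀ᵐ ω ∂P, ∀ k, randomWalk X k ω = randomWalk Y k ω := by
    filter_upwards [ae_all_iff.2 hXY] with ω hω k
    exact Finset.sum_congr rfl fun j _ => hω j
  set z : ℕ → ℂ := fun h => charFun (P.map (X 0)) (2 * Real.pi * (h * α)) with hzdef
  have hmap : IsProbabilityMeasure (P.map (X 0)) :=
    Measure.isProbabilityMeasure_map (hident 0).aemeasurable_fst
  have hz1 : ∀ h, ‖z h‖ ≤ 1 := fun h => norm_charFun_le_one _
  have hz : ∀ h n : ℕ, ∫ ω, unitExp (h * α * Y n ω) ∂P = z h := by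
    intro h n
    rw [integral_unitExp_mul_eq_charFun (hYm n), ← Measure.map_congr (hXY n), (hident n).map_eq]
  -- Replacing `α` by `dα` absorbs the integer `d`.
  set α' : ℝ := d * α with hα'
  set C' : ℝ := C * (d : ℝ) ^ (-γ) with hC'
  have hC'0 : 0 < C' := by positivity
  have hdio' : ∀ q : ℕ, 0 < q → C' * (q : ℝ) ^ (-γ) ≤ distInt (q * α') := by
    intro q hq
    have h1 := hdio (d * q) (by positivity)
    push_cast at h1
    rw [Real.mul_rpow hd'.le (by positivity), ← mul_assoc] at h1
    rwa [show (q : ℝ) * α' = d * q * α by rw [hα']; ring]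
  have hpos : ∀ h : ℕ, 0 < h → 0 < distInt (h * α') := fun h hh =>
    lt_of_lt_of_le (by positivity) (hdio' h hh)
  have hb1 : ∀ h : ℕ, c * distInt (h * α') ^ β ≤ ‖1 - z h‖ := by
    intro h
    have := hφ (h * α)
    rwa [show (d : ℝ) * (h * α) = h * α' by rw [hα']; ring] at this
  have hb2 : ∀ E : ℝ, γ * β ≤ E → ∀ h : ℕ, 0 < h →
      c * C' ^ β * (h : ℝ) ^ (-E) ≤ ‖1 - z h‖ := by
    intro E hE h hh
    have hh1 : (1 : ℝ) ≤ h := by exact_mod_cast hh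
    refine le_trans ?_ (hb1 h)
    rw [mul_assoc]
    gcongr
    calc C' ^ β * (h : ℝ) ^ (-E) ≤ C' ^ β * (h : ℝ) ^ (-γ * β) := by
          gcongr
          linarith
      _ = (C' * (h : ℝ) ^ (-γ)) ^ β := by
          rw [Real.mul_rpow hC'0.le (by positivity), ← Real.rpow_mul (by positivity)]
      _ ≤ _ := by
          gcongr
          exact hdio' h hh
  have hc₀ : 0 < c * C' ^ β := by positivity
  set W : ℕ → ℝ := fun H => ∑ h ∈ Finset.Icc 1 H, 1 / (h : ℝ) * (1 / √‖1 - z h‖) with hWdef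
  have hW : ∀ H, W H ≤ 1 / √c * ∑ h ∈ Finset.Icc 1 H, 1 / (h : ℝ) *
      distInt (h * α') ^ (-(β / 2)) := by
    intro H
    rw [hWdef, Finset.mul_sum]
    refine Finset.sum_le_sum fun h hh => ?_
    have h0 := hpos h (Finset.mem_Icc.1 hh).1
    have h1 : √c * distInt (h * α') ^ (β / 2) ≤ √‖1 - z h‖ := by
      have h2 := Real.sqrt_le_sqrt (hb1 h)
      rwa [Real.sqrt_mul hc.le, Real.sqrt_eq_rpow (distInt (h * α') ^ β), ← Real.rpow_mul h0.le,
        mul_one_div] at h2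
    calc 1 / (h : ℝ) * (1 / √‖1 - z h‖)
        ≤ 1 / (h : ℝ) * (1 / (√c * distInt (h * α') ^ (β / 2))) := by gcongr
      _ = _ := by
        rw [Real.rpow_neg h0.le]
        field_simp
  have hsc : 0 < 1 / √c := by positivity
  constructor
  · intro hγβ
    rw [le_div_iff₀ hβ] at hγβ
    obtain ⟨K, hK, hae⟩ := exists_ae_eventually_discrepancy_le (P := P) hYm hYindep α z hz hz1 hc₀
      (E := 2) (by norm_num) (hb2 2 hγβ)
    obtain ⟨K', hK', hWlog⟩ : ∃ K' : ℝ, 0 < K' ∧ ∀ H : ℕ,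
        W H ≤ K' * (1 + Real.log H) ^ (if β < 2 then 1 else 2 : ℕ) := by
      split_ifs with hβlt
      · obtain ⟨K', hK', h⟩ := exists_weightedSum_le_log hC'0 hdio' (p := β / 2) (by linarith)
          (by linarith) (by linarith)
        refine ⟨1 / √c * K', by positivity, fun H => (hW H).trans ?_⟩
        rw [pow_one, mul_assoc]
        exact mul_le_mul_of_nonneg_left (h H) hsc.le
      · have hβeq : β = 2 := le_antisymm hβ2 (not_lt.1 hβlt)
        subst hβeq
        obtain ⟨K', hK', h⟩ := exists_weightedSum_le_log_sq hC'0 hdio' (by linarith)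
        refine ⟨1 / √c * K', by positivity, fun H => (hW H).trans ?_⟩
        rw [mul_assoc, div_self (two_ne_zero)]
        exact mul_le_mul_of_nonneg_left (h H) hsc.le
    filter_upwards [hae, hwalk] with ω hω hwω
    simp_rw [hwω]
    exact isBigO_of_eventually_le_log
      (fun n => discrepancy_nonneg _ n) hK hK' hWlog hω
  · intro hγβ
    rw [div_lt_iff₀ hβ] at hγβ
    obtain ⟨K, hK, hae⟩ := exists_ae_eventually_discrepancy_le (P := P) hYm hYindep α z hz hz1 hc₀
      (E := β * γ) (by positivity) (hb2 _ (by linarith))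
    obtain ⟨K', hK', h⟩ := exists_weightedSum_le_rpow hC'0 hdio' (p := β / 2) (by linarith)
      (by linarith) (by linarith)
    filter_upwards [hae, hwalk] with ω hω hwω
    simp_rw [hwω]
    refine isBigO_of_eventually_le_rpow (by linarith) (fun n => discrepancy_nonneg _ n) hK
      (mul_pos hsc hK') (fun H => (hW H).trans ?_) hω
    rw [mul_assoc, show β * γ / 2 - 1 = γ * (β / 2) - 1 by ring]
    exact mul_le_mul_of_nonneg_left (h H) hsc.le

theorem theorem1 {Ω : Type*} [MeasurableSpace Ω] (P : Measure Ω) [IsProbabilityMeasure P]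
    (X : ℕ → Ω → ℝ) (hindep : iIndepFun X P) (hident : ∀ j, IdentDistrib (X j) (X 0) P P)
    (φ : ℝ → ℂ) (hφ : φ = charFun (P.map (X 0)))
    (α : ℝ) (hα : Irrational α) (γ C : ℝ) (hγ : 1 ≤ γ) (hC : 0 < C)
    (hdio : ∀ q : ℕ, 0 < q → C * (q : ℝ) ^ (-γ) ≤ distInt (q * α)) :
    -- part (i)
    (∀ (β c : ℝ) (d : ℕ), 0 < β → β ≤ 2 → 0 < c → 0 < d →
      (∀ x : ℝ, c * distInt (d * x) ^ β ≤ 1 - ‖φ (2 * Real.pi * x)‖) →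
      (γ ≤ 2 / β → ∀ᵐ ω ∂P,
        (fun N : ℕ => discrepancy (fun k => Int.fract (randomWalk X k ω * α)) N) =O[atTop]
          (fun N : ℕ => Real.sqrt (Real.log (Real.log N) / N) *
            Real.log N ^ (if β < 2 then 1 else 2 : ℕ))) ∧
      (2 / β < γ → ∀ᵐ ω ∂P,
        (fun N : ℕ => discrepancy (fun k => Int.fract (randomWalk X k ω * α)) N) =O[atTop]
          (fun N : ℕ => (Real.log (Real.log N) / N) ^ (1 / (β * γ))))) ∧
    -- part (ii)
    (∀ (c : ℝ) (d : ℕ), 0 < c → 0 < d →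
      (∀ x y : ℝ, c * distInt (d * (x - y)) ≤
        ‖φ (2 * Real.pi * x) - φ (2 * Real.pi * y)‖) →
      (γ ≤ 2 → ∀ᵐ ω ∂P,
        (fun N : ℕ => discrepancy (fun k => Int.fract (randomWalk X k ω * α)) N) =O[atTop]
          (fun N : ℕ => Real.sqrt (Real.log (Real.log N) / N) * Real.log N)) ∧
      (2 < γ → ∀ᵐ ω ∂P,
        (fun N : ℕ => discrepancy (fun k => Int.fract (randomWalk X k ω * α)) N) =O[atTop]
          (fun N : ℕ => (Real.log (Real.log N) / N) ^ (1 / γ)))) := by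
  subst hφ
  have hprob : IsProbabilityMeasure (P.map (X 0)) :=
    Measure.isProbabilityMeasure_map (hident 0).aemeasurable_fst
  refine ⟨fun β c d hβ hβ2 hc hd h => ?_, fun c d hc hd h => ?_⟩
  · refine ae_discrepancy_isBigO P X hindep hident α γ C hγ hC hdio β c d hβ hβ2 hc hd fun x => ?_
    have h1 := norm_sub_norm_le (1 : ℂ) (charFun (P.map (X 0)) (2 * Real.pi * x))
    rw [norm_one] at h1
    exact (h x).trans h1
  · have := ae_discrepancy_isBigO P X hindep hident α γ C hγ hC hdio 1 c d one_pos one_le_two hc hd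
      fun x => by
        -- `φ 0 = 1`, so this is the hypothesis at the pair `x, 0`.
        have h1 := h x 0
        rw [mul_zero, charFun_zero, probReal_univ, sub_zero, norm_sub_rev] at h1
        rw [Real.rpow_one]
        exact_mod_cast h1
    simpa using this
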